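/- Let $\mathbb{P}$ be a semifield (a multiplicative abelian group with a commutative, associative addition $\oplus$ over which multiplication distributes), let $\mathbb{Q}\mathbb{P}$ be the field of fractions of the group ring $\mathbb{Z}\mathbb{P}$, and let $\mathcal{F}$ be an extension field of $\mathbb{Q}\mathbb{P}$ (for instance the field of rational functions in $n$ variables over $\mathbb{Q}\mathbb{P}$). Let $(\mathbf{x},\mathbf{y},B,\mathbf{Z})$ be a generalized seed: $\mathbf{x}=(x_1,\dots,x_n)$ is a family in $\mathcal{F}$ algebraically independent over $\mathbb{Q}\mathbb{P}$, $\mathbf{y}\in\mathbb{P}^n$, $B=(b_{ij})$ is a skew-symmetrizable integer $n\times n$ matrix, and $Z_i(u)=\sum_{s=0}^{d_i}z_{i,s}u^s$ with $d_i\ge 1$, $z_{i,s}\in\mathbb{P}$ and $z_{i,0}=z_{i,d_i}=1$. With $[b]_+=\max(b,0)$ and $\hat y_k=y_k\prod_i x_i^{b_{ik}}$, its mutation in direction $k$ is $(\mathbf{x}',\mathbf{y}',B',\mathbf{Z}')$, where $x'_i=x_i$ and $Z'_i=Z_i$ for $i\neq k$, and $$x'_kx_k=\Big(\prod_i x_i^{[-b_{ik}]_+}\Big)^{d_k}\frac{Z_k(\hat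 y_k)}{Z_k|_{\mathbb{P}}(y_k)},\qquad Z'_k(u)=u^{d_k}Z_k(u^{-1}),$$ $$y'_k=y_k^{-1},\qquad y'_j=y_j\,(y_k^{d_k})^{[b_{kj}]_+}\,Z_k|_{\mathbb{P}}(y_k)^{-b_{kj}}\ \ (j\ne k),$$ $$b'_{ij}=-b_{ij}\ \text{ if } i=k \text{ or } j=k,\qquad b'_{ij}=b_{ij}+[b_{ik}]_+d_kb_{kj}+b_{ik}d_k[-b_{kj}]_+\ \text{ otherwise.}$$ Here $Z_k|_{\mathbb{P}}(y_k)=\bigoplus_s z_{k,s}y_k^s$. Ordinary seeds $(\mathbf{x},\mathbf{y},B)$ mutate by the same formulas with all $d_i=1$ and $Z_i(u)=1+u$. The seeds of a pattern are indexed by the vertices $t$ of the $n$-regular tree $\mathbb{T}_n$ with edges labeled by $1,\dots,n$; the given seed sits at $t_0$, and seeds joined by an edge labeled $k$ are mutations of each other in direction $k$. Write $B^t=(b^t_{ij})$ for the matrices of the generalized pattern. Replace $x_i$, $y_i$ and $z_{i,s}$ ($0<s<d_i$) by formal variables and $\mathbb{P}$ by the tropical semifield $\operatorname{Trop}(\mathbf{y},\mathbf{z})$,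 and compute in $\mathbb{Q}(\mathbf{x},\mathbf{y},\mathbf{z})$. The cluster variable at $t$ is then the $X$-function $X^t_j$. The integer $c^t_{ij}$ is the exponent of $y_i$ in the $j$-th coefficient at $t$, the integers $g^t_{ij}$ are the components of the degree $(g^t_{1j},\dots,g^t_{nj})$ of $X^t_j$ for the $\mathbb{Z}^n$-grading $\deg x_i=\mathbf{e}_i$, $\deg y_j=-(b_{1j},\dots,b_{nj})$, $\deg z_{i,s}=\mathbf{0}$, and $F^t_j(\mathbf{y},\mathbf{z})=X^t_j(\mathbf{1},\mathbf{y},\mathbf{z})$ are the $F$-polynomials. Let $F^t_j(\mathbf{y},\mathbf{0})$ be the specialization of all $z_{i,s}$ ($0<s<d_i$) to $0$. With $F^t_j|_{\mathbb{P}}(\mathbf{y},\mathbf{0})$ denoting its specialization at $\mathbf{y}\in\mathbb{P}^n$ through a subtraction-free expression, and $\hat{\mathbf{y}}$ denoting the initial $\hat y$-variables, put $$x^t_j\big|_{\mathbf{z}=\mathbf{0}}=\Big(\prod_i x_i^{g^t_{ij}}\Big)\frac{F^t_j|_{\mathcal{F}}(\hat{\mathbf{y}},\mathbf{0})}{F^t_j|_{\mathbb{P}}(\mathbf{y},\mathbf{0})},\qquad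 y^t_j\big|_{\mathbf{z}=\mathbf{0}}=\Big(\prod_i y_i^{c^t_{ij}}\Big)\prod_i F^t_i|_{\mathbb{P}}(\mathbf{y},\mathbf{0})^{b^t_{ij}}.$$ Let $({}^R\mathbf{x}^t,{}^R\mathbf{y}^t,{}^RB^t)$ be the seeds of the right-companion cluster algebra $\mathcal{A}(\mathbf{x},\mathbf{y}^{\mathbf{d}},BD)$, that is, of the ordinary cluster pattern with initial seed $\big(\mathbf{x},(y_1^{d_1},\dots,y_n^{d_n}),BD\big)$, where $D=\operatorname{diag}(d_1,\dots,d_n)$. **Theorem.** For every vertex $t\in\mathbb{T}_n$ the quantities above are well defined ($X^t_j$ is homogeneous, the substitutions $\mathbf{x}=\mathbf{1}$, $\mathbf{z}=\mathbf{0}$ and $\mathbf{y}\mapsto\hat{\mathbf{y}}$ are admissible, and $F^t_j(\mathbf{y},\mathbf{0})$ has a subtraction-free expression), and for all $1\le i,j\le n$ $$x^t_i\big|_{\mathbf{z}=\mathbf{0}}={}^Rx^t_i\qquad\text{and}\qquad\big(y^t_j\big|_{\mathbf{z}=\mathbf{0}}\big)^{d_j}={}^Ry^t_j.$$ -/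

import Mathlib

/-!
Conventions. A semifield is a type `P` with `[CommGroup P] [AddCommSemigroup P] [LeftDistribClass P]`:
a multiplicative abelian group with an auxiliary addition that is commutative, associative and
distributive. It has no zero, so it is not a semifield in the sense of Mathlib.
-/

noncomputable section

namespace ClusterAlg

/-! ### Semifields and the field `ℚP` -/

section Semifield

variable {P : Type*} [CommGroup P] [AddCommSemigroup P] [LeftDistribClass P]

/-- The auxiliary sum `f 0 ⊕ f 1 ⊕ ⋯ ⊕ f m` in a semifield. -/
def auxSum {P : Type*} [Add P] (f : ℕ → P) : ℕ → P
  | 0 => f 0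
  | m + 1 => auxSum f m + f (m + 1)

theorem mul_auxSum {P : Type*} [CommGroup P] [AddCommSemigroup P] [LeftDistribClass P]
    (a : P) (f : ℕ → P) (m : ℕ) : a * auxSum f m = auxSum (fun s => a * f s) m := by
  induction m with
  | zero => rfl
  | succ m ih => simp only [auxSum, mul_add, ih]

theorem auxSum_succ' {P : Type*} [CommGroup P] [AddCommSemigroup P] [LeftDistribClass P]
    (f : ℕ → P) (m : ℕ) : auxSum f (m + 1) = f 0 + auxSum (fun s => f (s + 1)) m := by
  induction m with
  | zero => rfl
  | succ m ih =>
    rw [auxSum, ih]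
    simp only [auxSum, add_assoc]

theorem semifield_pow_eq_one {P : Type*} [CommGroup P] [AddCommSemigroup P] [LeftDistribClass P]
    (p : P) (m : ℕ) (h : p ^ (m + 1) = 1) : p = 1 := by
  have key : p * auxSum (fun s => p ^ s) m = auxSum (fun s => p ^ s) m := by
    rw [mul_auxSum]
    cases m with
    | zero => simpa [auxSum] using h
    | succ k =>
      rw [auxSum_succ' (fun s => p ^ s) k]
      simp only [auxSum]
      rw [add_comm, ← pow_succ', h]
      simp only [pow_succ', pow_zero]
  exact mul_eq_right.mp key

/-- A semifield is torsion-free as a multiplicative group. -/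
instance semifield_isMulTorsionFree {P : Type*} [CommGroup P] [AddCommSemigroup P]
    [LeftDistribClass P] : IsMulTorsionFree P where
  pow_left_injective m hm := by
    intro a b hab
    obtain ⟨k, rfl⟩ := Nat.exists_eq_succ_of_ne_zero hm
    have h1 : (a / b) ^ (k + 1) = 1 := by
      rw [div_pow, div_eq_one]
      exact hab
    exact div_eq_one.mp (semifield_pow_eq_one _ _ h1)

instance semifield_uniqueProds {P : Type*} [CommGroup P] [AddCommSemigroup P]
    [LeftDistribClass P] : UniqueProds P where
  uniqueMul_of_nonempty := by
    classical
    intro A B hA hB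
    let H : Subgroup P := Subgroup.closure ((A ∪ B : Finset P) : Set P)
    have : Group.FG H := (Group.fg_iff_subgroup_fg H).mpr ⟨A ∪ B, rfl⟩
    have : Monoid.FG H := Group.fg_iff_monoid_fg.mp inferInstance
    have hAH : ∀ a ∈ A, a ∈ H := fun a ha =>
      Subgroup.subset_closure (by simp [ha])
    have hBH : ∀ b ∈ B, b ∈ H := fun b hb =>
      Subgroup.subset_closure (by simp [hb])
    obtain ⟨a0, ha0⟩ := hA
    obtain ⟨b0, hb0⟩ := hB
    obtain ⟨a, ha, b, hb, hab⟩ := UniqueProds.uniqueMul_of_nonempty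
      (G := H) (A := A.subtype (· ∈ H)) (B := B.subtype (· ∈ H))
      ⟨⟨a0, hAH a0 ha0⟩, by simpa using ha0⟩ ⟨⟨b0, hBH b0 hb0⟩, by simpa using hb0⟩
    refine ⟨a, by simpa using ha, b, by simpa using hb, ?_⟩
    intro a' b' ha' hb' h
    have := @hab ⟨a', hAH a' ha'⟩ ⟨b', hBH b' hb'⟩ (by simpa using ha') (by simpa using hb')
      (Subtype.ext h)
    exact ⟨congrArg Subtype.val this.1, congrArg Subtype.val this.2⟩

end Semifield

/-- `ℚP`: the field of fractions of the group ring `ℤP` (a domain, as `P` is torsion-free). -/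
abbrev QP (P : Type*) [CommGroup P] : Type _ := FractionRing (MonoidAlgebra ℤ P)

/-- The inclusion of `P` into an extension field `L` of `ℚP`. -/
def coeffHom (P : Type*) [CommGroup P] [AddCommSemigroup P] [LeftDistribClass P]
    (L : Type*) [Field L] [Algebra (QP P) L] : P →* L :=
  ((algebraMap (QP P) L).comp (algebraMap (MonoidAlgebra ℤ P) (QP P))).toMonoidHom.comp
    (MonoidAlgebra.of ℤ P)

/-! ### Tropical semifields -/

/-- `Trop(v_i : i ∈ σ)`: the free abelian group on the `v_i`, written multiplicatively; an element
is the finitely supported function of its exponents. -/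
def Trop (σ : Type*) : Type _ := Multiplicative (σ →₀ ℤ)

namespace Trop

variable {σ : Type*}

instance : CommGroup (Trop σ) := inferInstanceAs (CommGroup (Multiplicative (σ →₀ ℤ)))

/-- The exponents of a monomial. -/
def exponent (a : Trop σ) : σ →₀ ℤ := Multiplicative.toAdd a

/-- The monomial with given exponents. -/
def ofExponent (e : σ →₀ ℤ) : Trop σ := Multiplicative.ofAdd e

/-- The generator `v_i`. -/
def gen (i : σ) : Trop σ := ofExponent (Finsupp.single i 1)

/-- `∏ v_i ^ a_i ⊕ ∏ v_i ^ b_i = ∏ v_i ^ min (a_i, b_i)`. -/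
instance : AddCommSemigroup (Trop σ) where
  add a b := ofExponent (exponent a ⊓ exponent b)
  add_assoc a b c := inf_assoc (exponent a) (exponent b) (exponent c)
  add_comm a b := inf_comm (exponent a) (exponent b)

instance : LeftDistribClass (Trop σ) where
  left_distrib a b c := by
    change exponent a + (exponent b ⊓ exponent c)
      = (exponent a + exponent b) ⊓ (exponent a + exponent c)
    ext i
    simp only [Finsupp.add_apply, Finsupp.inf_apply]
    exact (min_add_add_left _ _ _).symm

/-- The monomial `∏ v_i ^ a_i`, read in a field in which the `v_i` are given nonzero elements. -/
def toField {L : Type*} [Field L] (v : σ → L) (hv : ∀ i, v i ≠ 0) : Trop σ →* L where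
  toFun a := (exponent a).prod fun i m => v i ^ m
  map_one' := Finsupp.prod_zero_index
  map_mul' a b := by
    classical
    exact Finsupp.prod_add_index' (f := exponent a) (g := exponent b)
      (fun i => zpow_zero _) (fun i m m' => zpow_add₀ (hv i) m m')

end Trop

/-! ### Rational functions, their values in fields and in semifields -/

/-- The field `ℚ(v_i : i ∈ σ)` of rational functions in the variables `v_i`. -/
abbrev Rat (σ : Type*) : Type _ := FractionRing (MvPolynomial σ ℤ)

/-- The variable `v_i`. -/
def var {σ : Type*} (i : σ) : Rat σ := algebraMap (MvPolynomial σ ℤ) (Rat σ) (MvPolynomial.X i)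

theorem var_ne_zero {σ : Type*} (i : σ) : var i ≠ 0 := by
  intro h
  exact MvPolynomial.X_ne_zero (R := ℤ) i
    ((IsFractionRing.injective (MvPolynomial σ ℤ) (Rat σ)) (by rw [map_zero]; exact h))

/-- The rational function `f` can be evaluated at the point `a`: it is a quotient of polynomials
whose denominator does not vanish at `a`. -/
def IsDefinedAt {σ L : Type*} [Field L] (f : Rat σ) (a : σ → L) : Prop :=
  ∃ q : MvPolynomial σ ℤ × MvPolynomial σ ℤ, MvPolynomial.aeval a q.2 ≠ 0 ∧
    f = algebraMap _ (Rat σ) q.1 / algebraMap _ (Rat σ) q.2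

open Classical in
/-- The value `f(a)` of a rational function that is defined at `a` (it does not depend on the
chosen quotient). On polynomials this is the usual evaluation. -/
def ratEval {σ L : Type*} [Field L] (a : σ → L) (f : Rat σ) : L :=
  if h : IsDefinedAt f a then
    MvPolynomial.aeval a h.choose.1 / MvPolynomial.aeval a h.choose.2
  else 0

/-- A polynomial with coefficients in `ℕ`, viewed as a rational function. -/
def ofNatPoly {σ : Type*} (N : MvPolynomial σ ℕ) : Rat σ :=
  algebraMap (MvPolynomial σ ℤ) (Rat σ) (MvPolynomial.map (Nat.castRingHom ℤ) N)

/-- `f` belongs to the universal semifield `ℚ_sf(v_i : i ∈ σ)`: it is a ratio of two nonzero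
polynomials with nonnegative integer coefficients. -/
def IsSubtractionFree {σ : Type*} (f : Rat σ) : Prop :=
  ∃ q : MvPolynomial σ ℕ × MvPolynomial σ ℕ, q.1 ≠ 0 ∧ q.2 ≠ 0 ∧
    f = ofNatPoly q.1 / ofNatPoly q.2

section Specialize

variable {σ P : Type*} [CommGroup P] [AddCommSemigroup P]

/-- The value of a polynomial with coefficients in `ℕ` at a point of a semifield, in `P ∪ {0}`:
a coefficient `c` stands for a `c`-fold auxiliary sum. -/
def natPolyEvalZero (p : σ → P) (N : MvPolynomial σ ℕ) : WithZero P :=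
  ∑ m ∈ N.support, N.coeff m • ((m.prod fun i e => p i ^ e : P) : WithZero P)

open Classical in
/-- The value in `P` of a nonzero polynomial with coefficients in `ℕ`. -/
def natPolyEval (p : σ → P) (N : MvPolynomial σ ℕ) : P :=
  if h : natPolyEvalZero p N ≠ 0 then WithZero.unzero h else 1

open Classical in
/-- The specialization `f|_P(p)` of `f ∈ ℚ_sf(v_i : i ∈ σ)` under the semifield homomorphism
`ℚ_sf(v_i : i ∈ σ) → P`, `v_i ↦ p_i` (it does not depend on the chosen ratio). -/
def specialize (p : σ → P) (f : Rat σ) : P :=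
  if h : IsSubtractionFree f then natPolyEval p h.choose.1 / natPolyEval p h.choose.2 else 1

end Specialize

/-- A nonzero rational function is homogeneous of degree `g` for the grading in which `v_i` has
degree `w i`: it is a ratio of two nonzero homogeneous polynomials whose degrees differ by `g`. -/
def IsHomogeneousOfDegree {σ G : Type*} [AddCommGroup G] (w : σ → G) (f : Rat σ) (g : G) : Prop :=
  ∃ (N M : MvPolynomial σ ℤ) (a b : G), N ≠ 0 ∧ M ≠ 0 ∧
    N.IsWeightedHomogeneous w a ∧ M.IsWeightedHomogeneous w b ∧
    f = algebraMap _ (Rat σ) N / algebraMap _ (Rat σ) M ∧ g = a - b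

/-! ### The labeled tree -/

/-- The vertices of the `n`-regular tree `𝕋_n` with edges labeled by `1, …, n` (here by `Fin n`)
and root `t₀ = []`: the vertex `t` is the word of the labels on the path without backtracking
from `t₀` to `t`, the last edge first. Thus `t` and `k :: t` are joined by an edge labeled `k`. -/
def TreeVertex (n : ℕ) : Type := {w : List (Fin n) // w.IsChain (· ≠ ·)}

/-! ### Cluster algebras -/

/-- An integer matrix is skew-symmetrizable if `S B` is skew-symmetric for some diagonal
matrix `S` with positive integer entries. -/
def IsSkewSymmetrizable {n : ℕ} (B : Matrix (Fin n) (Fin n) ℤ) : Prop :=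
  ∃ s : Fin n → ℤ, (∀ i, 0 < s i) ∧ ∀ i j, s i * B i j = -(s j * B j i)

/-- The data `(x, y, B)` of a labeled seed, with coefficients in `P` and cluster variables in `L`. -/
structure Seed (n : ℕ) (P L : Type*) where
  /-- The cluster. -/
  x : Fin n → L
  /-- The coefficients. -/
  y : Fin n → P
  /-- The exchange matrix. -/
  B : Matrix (Fin n) (Fin n) ℤ

/-- The `ŷ`-variable `ŷ_k = y_k ∏_i x_i ^ b_{ik}`, for an embedding `e` of `P` into `L`. -/
def hatY {n : ℕ} {P L : Type*} [CommGroup P] [Field L] (e : P →* L)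
    (x : Fin n → L) (y : Fin n → P) (B : Matrix (Fin n) (Fin n) ℤ) (k : Fin n) : L :=
  e (y k) * ∏ i, x i ^ B i k

/-- Seed mutation in direction `k`. -/
def Seed.mutate {n : ℕ} {P L : Type*} [CommGroup P] [AddCommSemigroup P] [Field L] (e : P →* L)
    (k : Fin n) (S : Seed n P L) : Seed n P L where
  x i := if i = k then
      (S.x k)⁻¹ * (∏ l, S.x l ^ (max (-S.B l k) 0)) *
        ((1 + hatY e S.x S.y S.B k) / e (1 + S.y k))
    else S.x i
  y j := if j = k then (S.y k)⁻¹
    else S.y j * S.y k ^ (max (S.B k j) 0) * (1 + S.y k) ^ (-S.B k j)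
  B := Matrix.of fun i j => if i = k ∨ j = k then -S.B i j
    else S.B i j + max (S.B i k) 0 * S.B k j + S.B i k * max (-S.B k j) 0

/-- The cluster pattern with initial seed `S`: the seed reached along a path from `t₀`. -/
def Seed.at {n : ℕ} {P L : Type*} [CommGroup P] [AddCommSemigroup P] [Field L] (e : P →* L)
    (S : Seed n P L) : List (Fin n) → Seed n P L
  | [] => S
  | k :: t => (Seed.at e S t).mutate e k

/-! ### Generalized cluster algebras -/

/-- The data `(x, y, B, Z)` of a generalized seed, where the exchange polynomial
`Z_i(u) = ∑_{s ≤ d_i} z_{i,s} u ^ s` has degree `d_i` and coefficients `z_{i,s} ∈ P`; the values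
`z i s` with `s > d i` are irrelevant. -/
structure GenSeed (n : ℕ) (P L : Type*) where
  /-- The cluster. -/
  x : Fin n → L
  /-- The coefficients. -/
  y : Fin n → P
  /-- The exchange matrix. -/
  B : Matrix (Fin n) (Fin n) ℤ
  /-- The degrees of the exchange polynomials. -/
  d : Fin n → ℕ
  /-- The coefficients of the exchange polynomials. -/
  z : Fin n → ℕ → P

/-- The requirements on a generalized seed over the semifield `P` in an extension field `L`
of `ℚP`. -/
structure GenSeed.IsGenSeed {n : ℕ} {P L : Type*} [CommGroup P] [AddCommSemigroup P]
    [LeftDistribClass P] [Field L] [Algebra (QP P) L] (S : GenSeed n P L) : Prop where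
  algebraicIndependent : AlgebraicIndependent (QP P) S.x
  skewSymmetrizable : IsSkewSymmetrizable S.B
  d_pos : ∀ i, 0 < S.d i
  z_zero : ∀ i, S.z i 0 = 1
  z_top : ∀ i, S.z i (S.d i) = 1

/-- Generalized seed mutation in direction `k`. -/
def GenSeed.mutate {n : ℕ} {P L : Type*} [CommGroup P] [AddCommSemigroup P] [Field L] (e : P →* L)
    (k : Fin n) (S : GenSeed n P L) : GenSeed n P L where
  x i := if i = k then
      (S.x k)⁻¹ * (∏ l, S.x l ^ (max (-S.B l k) 0)) ^ S.d k *
        ((∑ s ∈ Finset.range (S.d k + 1), e (S.z k s) * hatY e S.x S.y S.B k ^ s) /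
          e (auxSum (fun s => S.z k s * S.y k ^ s) (S.d k)))
    else S.x i
  y j := if j = k then (S.y k)⁻¹
    else S.y j * (S.y k ^ S.d k) ^ (max (S.B k j) 0) *
      auxSum (fun s => S.z k s * S.y k ^ s) (S.d k) ^ (-S.B k j)
  B := Matrix.of fun i j => if i = k ∨ j = k then -S.B i j
    else S.B i j + max (S.B i k) 0 * S.d k * S.B k j + S.B i k * S.d k * max (-S.B k j) 0
  d := S.d
  z i s := if i = k then S.z k (S.d k - s) else S.z i s

/-- The generalized cluster pattern with initial generalized seed `S`: the generalized seed
reached along a path from `t₀`. -/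
def GenSeed.at {n : ℕ} {P L : Type*} [CommGroup P] [AddCommSemigroup P] [Field L] (e : P →* L)
    (S : GenSeed n P L) : List (Fin n) → GenSeed n P L
  | [] => S
  | k :: t => (GenSeed.at e S t).mutate e k

/-! ### `X`-functions, `c`-vectors, `g`-vectors and `F`-polynomials -/

section Formal

variable {n : ℕ}

/-- The indices `(i, s)`, `0 < s < d_i`, of the formal variables `z_{i,s}`. -/
abbrev ZIndex (d : Fin n → ℕ) : Type := Σ i : Fin n, {s : ℕ // 0 < s ∧ s < d i}

/-- The indices of the formal variables `y_i` and `z_{i,s}`. -/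
abbrev YZ (d : Fin n → ℕ) : Type := Fin n ⊕ ZIndex d

/-- The indices of the formal variables `x_i`, `y_i` and `z_{i,s}`. -/
abbrev XYZ (d : Fin n → ℕ) : Type := Fin n ⊕ YZ d

/-- The embedding of `Trop(y, z)` into `ℚ(x, y, z)`. -/
def formalHom (d : Fin n → ℕ) : Trop (YZ d) →* Rat (XYZ d) :=
  Trop.toField (fun i => var (Sum.inr i)) (fun i => var_ne_zero (Sum.inr i))

/-- The generalized seed over `Trop(y, z)` whose `x`-, `y`- and `z`-variables are formal
variables, with `z_{i,0} = z_{i,d_i} = 1`. -/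
def formalSeed (B : Matrix (Fin n) (Fin n) ℤ) (d : Fin n → ℕ) :
    GenSeed n (Trop (YZ d)) (Rat (XYZ d)) where
  x i := var (Sum.inl i)
  y i := Trop.gen (Sum.inl i)
  B := B
  d := d
  z i s := if h : 0 < s ∧ s < d i then Trop.gen (Sum.inr ⟨i, s, h⟩) else 1

/-- The generalized seed at `t` of the pattern with formal initial seed. -/
def formalAt (B : Matrix (Fin n) (Fin n) ℤ) (d : Fin n → ℕ) (t : List (Fin n)) :
    GenSeed n (Trop (YZ d)) (Rat (XYZ d)) :=
  (formalSeed B d).at (formalHom d) t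

/-- The matrix `B^t`. -/
def exchangeMatrix (B : Matrix (Fin n) (Fin n) ℤ) (d : Fin n → ℕ) (t : List (Fin n)) :
    Matrix (Fin n) (Fin n) ℤ :=
  (formalAt B d t).B

/-- The `X`-function `X^t_j ∈ ℚ(x, y, z)`. -/
def Xfun (B : Matrix (Fin n) (Fin n) ℤ) (d : Fin n → ℕ) (t : List (Fin n)) (j : Fin n) :
    Rat (XYZ d) :=
  (formalAt B d t).x j

/-- The entry `c^t_{ij}`: the exponent of `y_i` in the `j`-th coefficient at `t` over
`Trop(y, z)`. -/
def cVec (B : Matrix (Fin n) (Fin n) ℤ) (d : Fin n → ℕ) (t : List (Fin n)) (i j : Fin n) : ℤ :=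
  ((formalAt B d t).y j).exponent (Sum.inl i)

/-- The `ℤ^n`-grading `deg x_i = e_i`, `deg y_j = -b_j` (`b_j` the `j`-th column of `B`),
`deg z_{i,s} = 0`. -/
def gDegree (B : Matrix (Fin n) (Fin n) ℤ) (d : Fin n → ℕ) : XYZ d → (Fin n → ℤ)
  | Sum.inl i => Pi.single i 1
  | Sum.inr (Sum.inl j) => fun i => -B i j
  | Sum.inr (Sum.inr _) => 0

open Classical in
/-- The entry `g^t_{ij}`: the `i`-th component of the degree of `X^t_j`. -/
def gVec (B : Matrix (Fin n) (Fin n) ℤ) (d : Fin n → ℕ) (t : List (Fin n)) (i j : Fin n) : ℤ :=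
  if h : ∃ g, IsHomogeneousOfDegree (gDegree B d) (Xfun B d t j) g then h.choose i else 0

/-- The point `x = 1`, with `y` and `z` unchanged. -/
def xOne (d : Fin n → ℕ) : XYZ d → Rat (YZ d) :=
  Sum.elim (fun _ => 1) var

/-- The `F`-polynomial `F^t_j(y, z) = X^t_j(1, y, z)`, as an element of `ℚ(y, z)`. -/
def Fpoly (B : Matrix (Fin n) (Fin n) ℤ) (d : Fin n → ℕ) (t : List (Fin n)) (j : Fin n) :
    Rat (YZ d) :=
  ratEval (xOne d) (Xfun B d t j)

/-- The point `z = 0`, with `y` unchanged. -/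
def zZero (d : Fin n → ℕ) : YZ d → Rat (Fin n) :=
  Sum.elim var (fun _ => 0)

/-- The specialized `F`-polynomial `F^t_j(y, 0)`, as an element of `ℚ(y)`. -/
def FpolyZero (B : Matrix (Fin n) (Fin n) ℤ) (d : Fin n → ℕ) (t : List (Fin n)) (j : Fin n) :
    Rat (Fin n) :=
  ratEval (zZero d) (Fpoly B d t j)

end Formal

/-! ### The variables at `z = 0` and the right companion -/

section Companion

variable {n : ℕ} {P L : Type*} [CommGroup P] [AddCommSemigroup P] [LeftDistribClass P]
  [Field L] [Algebra (QP P) L]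

/-- The initial `ŷ`-variables of a generalized seed. -/
def GenSeed.hat (S : GenSeed n P L) : Fin n → L :=
  hatY (coeffHom P L) S.x S.y S.B

/-- `x^t_j|_{z = 0} = (∏_i x_i ^ g^t_{ij}) F^t_j(ŷ, 0) / F^t_j(·, 0)|_P(y)`. -/
def GenSeed.xAtZero (S : GenSeed n P L) (t : List (Fin n)) (j : Fin n) : L :=
  (∏ i, S.x i ^ gVec S.B S.d t i j) *
    (ratEval S.hat (FpolyZero S.B S.d t j) /
      coeffHom P L (specialize S.y (FpolyZero S.B S.d t j)))

/-- `y^t_j|_{z = 0} = (∏_i y_i ^ c^t_{ij}) ∏_i (F^t_i(·, 0)|_P(y)) ^ b^t_{ij}`. -/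
def GenSeed.yAtZero (S : GenSeed n P L) (t : List (Fin n)) (j : Fin n) : P :=
  (∏ i, S.y i ^ cVec S.B S.d t i j) *
    ∏ i, specialize S.y (FpolyZero S.B S.d t i) ^ exchangeMatrix S.B S.d t i j

/-- The initial seed `(x, y^d, BD)` of the right companion, `D = diag(d_1, …, d_n)`. -/
def GenSeed.rightCompanion (S : GenSeed n P L) : Seed n P L where
  x := S.x
  y i := S.y i ^ S.d i
  B := S.B * Matrix.diagonal fun i => (S.d i : ℤ)

/-- The seed of the right companion at `t`. -/
def GenSeed.rightCompanionAt (S : GenSeed n P L) (t : List (Fin n)) : Seed n P L :=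
  S.rightCompanion.at (coeffHom P L) t

end Companion

end ClusterAlg

end

noncomputable section

namespace ClusterAlg

/-! ### Relations compatible with multiplication and division -/

/-- A relation between two commutative groups (possibly with zero) that respects products and
inverses. -/
structure IsMulRel {K A : Type*} [DivisionCommMonoid K] [DivisionCommMonoid A]
    (R : K → A → Prop) : Prop where
  one : R 1 1
  mul : ∀ {f g a b}, R f a → R g b → R (f * g) (a * b)
  inv : ∀ {f a}, R f a → R f⁻¹ a⁻¹

namespace IsMulRel

variable {K A : Type*} [DivisionCommMonoid K] [DivisionCommMonoid A] {R : K → A → Prop}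

theorem pow (h : IsMulRel R) {f : K} {a : A} (hf : R f a) (m : ℕ) : R (f ^ m) (a ^ m) := by
  induction m with
  | zero => simpa using h.one
  | succ m ih =>
    rw [pow_succ, pow_succ]
    exact h.mul ih hf

theorem zpow (h : IsMulRel R) {f : K} {a : A} (hf : R f a) (m : ℤ) : R (f ^ m) (a ^ m) := by
  cases m with
  | ofNat m => simpa using h.pow hf m
  | negSucc m =>
    rw [zpow_negSucc, zpow_negSucc]
    exact h.inv (h.pow hf _)

theorem prod (h : IsMulRel R) {ι : Type*} (s : Finset ι) {f : ι → K} {a : ι → A}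
    (hf : ∀ i, R (f i) (a i)) : R (∏ i ∈ s, f i) (∏ i ∈ s, a i) := by
  classical
  induction s using Finset.induction_on with
  | empty => simpa using h.one
  | insert i s hi ih =>
    rw [Finset.prod_insert hi, Finset.prod_insert hi]
    exact h.mul (hf i) ih

end IsMulRel

/-! ### Values of rational functions in fields -/

section Eval

variable {σ L : Type*} [Field L] {a : σ → L} {f g : Rat σ} {v w : L}

theorem algebraMap_ne_zero_of_aeval {q : MvPolynomial σ ℤ} (h : MvPolynomial.aeval a q ≠ 0) :
    algebraMap (MvPolynomial σ ℤ) (Rat σ) q ≠ 0 := by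
  intro h0
  rw [IsFractionRing.to_map_eq_zero_iff] at h0
  exact h (by rw [h0, map_zero])

/-- The rational function `f` is defined at `a` and takes the value `v` there. -/
def EvalsTo (a : σ → L) (f : Rat σ) (v : L) : Prop :=
  ∃ p q : MvPolynomial σ ℤ, MvPolynomial.aeval a q ≠ 0 ∧
    f = algebraMap _ (Rat σ) p / algebraMap _ (Rat σ) q ∧
    v = MvPolynomial.aeval a p / MvPolynomial.aeval a q

theorem EvalsTo.unique (hf : EvalsTo a f v) (hg : EvalsTo a f w) : v = w := by
  obtain ⟨p, q, hq, rfl, rfl⟩ := hf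
  obtain ⟨p', q', hq', h, rfl⟩ := hg
  rw [div_eq_div_iff (algebraMap_ne_zero_of_aeval hq) (algebraMap_ne_zero_of_aeval hq'),
    ← map_mul, ← map_mul] at h
  have h' := IsFractionRing.injective (MvPolynomial σ ℤ) (Rat σ) h
  rw [div_eq_div_iff hq hq', ← map_mul, ← map_mul, h']

theorem EvalsTo.isDefinedAt (hf : EvalsTo a f v) : IsDefinedAt f a := by
  obtain ⟨p, q, hq, h, -⟩ := hf
  exact ⟨(p, q), hq, h⟩

theorem EvalsTo.ratEval_eq (hf : EvalsTo a f v) : ratEval a f = v := by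
  have h := hf.isDefinedAt
  rw [ratEval, dif_pos h]
  exact EvalsTo.unique ⟨_, _, h.choose_spec.1, h.choose_spec.2, rfl⟩ hf

theorem evalsTo_algebraMap (a : σ → L) (p : MvPolynomial σ ℤ) :
    EvalsTo a (algebraMap _ (Rat σ) p) (MvPolynomial.aeval a p) :=
  ⟨p, 1, by simp, by simp, by simp⟩

theorem evalsTo_var (a : σ → L) (i : σ) : EvalsTo a (var i) (a i) := by
  have h := evalsTo_algebraMap a (MvPolynomial.X i)
  rw [MvPolynomial.aeval_X] at h
  exact h

theorem evalsTo_zero (a : σ → L) : EvalsTo a (0 : Rat σ) 0 := by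
  simpa using evalsTo_algebraMap a 0

theorem evalsTo_one (a : σ → L) : EvalsTo a (1 : Rat σ) 1 := by
  simpa using evalsTo_algebraMap a 1

theorem EvalsTo.mul (hf : EvalsTo a f v) (hg : EvalsTo a g w) : EvalsTo a (f * g) (v * w) := by
  obtain ⟨p, q, hq, rfl, rfl⟩ := hf
  obtain ⟨p', q', hq', rfl, rfl⟩ := hg
  refine ⟨p * p', q * q', ?_, ?_, ?_⟩
  · rw [map_mul]
    exact mul_ne_zero hq hq'
  · rw [map_mul, map_mul, div_mul_div_comm]
  · rw [map_mul, map_mul, div_mul_div_comm]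

theorem EvalsTo.add (hf : EvalsTo a f v) (hg : EvalsTo a g w) : EvalsTo a (f + g) (v + w) := by
  obtain ⟨p, q, hq, rfl, rfl⟩ := hf
  obtain ⟨p', q', hq', rfl, rfl⟩ := hg
  refine ⟨p * q' + q * p', q * q', ?_, ?_, ?_⟩
  · rw [map_mul]
    exact mul_ne_zero hq hq'
  · rw [div_add_div _ _ (algebraMap_ne_zero_of_aeval hq) (algebraMap_ne_zero_of_aeval hq')]
    simp only [map_mul, map_add]
  · rw [div_add_div _ _ hq hq']
    simp only [map_mul, map_add]

theorem EvalsTo.inv (hf : EvalsTo a f v) (hv : v ≠ 0) : EvalsTo a f⁻¹ v⁻¹ := by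
  obtain ⟨p, q, hq, rfl, rfl⟩ := hf
  refine ⟨q, p, fun h => hv (by rw [h, zero_div]), ?_, ?_⟩
  · rw [inv_div]
  · rw [inv_div]

theorem EvalsTo.sum {ι : Type*} (s : Finset ι) {f : ι → Rat σ} {v : ι → L}
    (h : ∀ i ∈ s, EvalsTo a (f i) (v i)) : EvalsTo a (∑ i ∈ s, f i) (∑ i ∈ s, v i) := by
  classical
  induction s using Finset.induction_on with
  | empty => simpa using evalsTo_zero a
  | insert i s hi ih =>
    rw [Finset.sum_insert hi, Finset.sum_insert hi]
    exact (h i (Finset.mem_insert_self i s)).add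
      (ih fun j hj => h j (Finset.mem_insert_of_mem hj))

theorem EvalsTo.ne_zero (hf : EvalsTo a f v) (hv : v ≠ 0) : f ≠ 0 := by
  rintro rfl
  exact hv (hf.unique (evalsTo_zero a))

/-- `f` is defined at `a` and takes the nonzero value `v` there. -/
def EvalsToUnit (a : σ → L) (f : Rat σ) (v : L) : Prop :=
  EvalsTo a f v ∧ v ≠ 0

theorem isMulRel_evalsToUnit (a : σ → L) : IsMulRel (EvalsToUnit a) where
  one := ⟨evalsTo_one a, one_ne_zero⟩
  mul hf hg := ⟨hf.1.mul hg.1, mul_ne_zero hf.2 hg.2⟩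
  inv hf := ⟨hf.1.inv hf.2, inv_ne_zero hf.2⟩

end Eval

/-! ### Homogeneous rational functions -/

section Homogeneous

variable {σ G : Type*} [AddCommGroup G] {w : σ → G} {f g : Rat σ} {c c' : G}

theorem IsHomogeneousOfDegree.unique (hf : IsHomogeneousOfDegree w f c)
    (hg : IsHomogeneousOfDegree w f c') : c = c' := by
  obtain ⟨N, M, a, b, hN, hM, hNa, hMb, rfl, rfl⟩ := hf
  obtain ⟨N', M', a', b', hN', hM', hNa', hMb', h, rfl⟩ := hg
  rw [div_eq_div_iff (by simpa using hM) (by simpa using hM'), ← map_mul, ← map_mul] at h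
  have h' := IsFractionRing.injective (MvPolynomial σ ℤ) (Rat σ) h
  have h1 := hNa.mul hMb'
  rw [h'] at h1
  have := MvPolynomial.IsWeightedHomogeneous.inj_right (mul_ne_zero hN' hM) h1 (hNa'.mul hMb)
  rw [sub_eq_sub_iff_add_eq_add, this]

theorem isHomogeneousOfDegree_var (w : σ → G) (i : σ) :
    IsHomogeneousOfDegree w (var i) (w i) :=
  ⟨MvPolynomial.X i, 1, w i, 0, MvPolynomial.X_ne_zero i, one_ne_zero,
    MvPolynomial.isWeightedHomogeneous_X ℤ w i, MvPolynomial.isWeightedHomogeneous_one ℤ w,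
    by simp [var], by simp⟩

theorem IsHomogeneousOfDegree.add (hf : IsHomogeneousOfDegree w f c)
    (hg : IsHomogeneousOfDegree w g c) (h : f + g ≠ 0) : IsHomogeneousOfDegree w (f + g) c := by
  obtain ⟨N, M, a, b, hN, hM, hNa, hMb, rfl, rfl⟩ := hf
  obtain ⟨N', M', a', b', hN', hM', hNa', hMb', rfl, hc⟩ := hg
  have e : algebraMap _ (Rat σ) N / algebraMap _ (Rat σ) M +
      algebraMap _ (Rat σ) N' / algebraMap _ (Rat σ) M' =
      algebraMap _ (Rat σ) (N * M' + M * N') / algebraMap _ (Rat σ) (M * M') := by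
    rw [div_add_div _ _ (by simpa using hM) (by simpa using hM')]
    simp only [map_mul, map_add]
  have hd : b + a' = a + b' := (sub_eq_sub_iff_add_eq_add.mp hc).symm ▸ add_comm b a'
  refine ⟨N * M' + M * N', M * M', a + b', b + b', ?_, mul_ne_zero hM hM', ?_, hMb.mul hMb', e,
    by abel⟩
  · intro h0
    exact h (by rw [e, h0, map_zero, zero_div])
  · exact (hNa.mul hMb').add (hd ▸ hMb.mul hNa')

/-- A nonzero sum of homogeneous functions of degree `c` is homogeneous of degree `c`. -/
theorem IsHomogeneousOfDegree.sum {ι : Type*} (s : Finset ι) {f : ι → Rat σ}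
    (hf : ∀ i ∈ s, IsHomogeneousOfDegree w (f i) c) (h : ∑ i ∈ s, f i ≠ 0) :
    IsHomogeneousOfDegree w (∑ i ∈ s, f i) c := by
  classical
  induction s using Finset.induction_on with
  | empty => simp at h
  | insert i s hi ih =>
    rw [Finset.sum_insert hi] at h ⊢
    have hi' := hf i (Finset.mem_insert_self i s)
    by_cases h0 : ∑ j ∈ s, f j = 0
    · rwa [h0, add_zero]
    · exact hi'.add (ih (fun j hj => hf j (Finset.mem_insert_of_mem hj)) h0) h

theorem isMulRel_isHomogeneousOfDegree (w : σ → G) :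
    IsMulRel fun (f : Rat σ) (c : Multiplicative G) => IsHomogeneousOfDegree w f c.toAdd where
  one := ⟨1, 1, 0, 0, one_ne_zero, one_ne_zero, MvPolynomial.isWeightedHomogeneous_one ℤ w,
    MvPolynomial.isWeightedHomogeneous_one ℤ w, by simp, by simp⟩
  mul := by
    rintro f g c c' ⟨N, M, a, b, hN, hM, hNa, hMb, rfl, hc⟩
      ⟨N', M', a', b', hN', hM', hNa', hMb', rfl, hc'⟩
    refine ⟨N * N', M * M', a + a', b + b', mul_ne_zero hN hN', mul_ne_zero hM hM',
      hNa.mul hNa', hMb.mul hMb', ?_, ?_⟩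
    · rw [map_mul, map_mul, div_mul_div_comm]
    · rw [toAdd_mul, hc, hc', add_sub_add_comm]
  inv := by
    rintro f c ⟨N, M, a, b, hN, hM, hNa, hMb, rfl, hc⟩
    refine ⟨M, N, b, a, hM, hN, hMb, hNa, by rw [inv_div], ?_⟩
    rw [toAdd_inv, hc, neg_sub]

end Homogeneous

/-! ### Specialization of subtraction-free functions -/

section SubtractionFree

variable {σ : Type*}

theorem ofNatPoly_injective : Function.Injective (ofNatPoly (σ := σ)) :=
  (IsFractionRing.injective (MvPolynomial σ ℤ) (Rat σ)).comp
    (MvPolynomial.map_injective _ Nat.cast_injective)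

theorem ofNatPoly_mul (N M : MvPolynomial σ ℕ) :
    ofNatPoly (N * M) = ofNatPoly N * ofNatPoly M := by
  simp only [ofNatPoly, map_mul]

theorem ofNatPoly_add (N M : MvPolynomial σ ℕ) :
    ofNatPoly (N + M) = ofNatPoly N + ofNatPoly M := by
  simp only [ofNatPoly, map_add]

theorem ofNatPoly_ne_zero {N : MvPolynomial σ ℕ} (h : N ≠ 0) : ofNatPoly N ≠ 0 := by
  intro h0
  exact h (ofNatPoly_injective (h0.trans (by simp [ofNatPoly])))

theorem IsSubtractionFree.ne_zero {f : Rat σ} (h : IsSubtractionFree f) : f ≠ 0 := by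
  obtain ⟨q, h1, h2, rfl⟩ := h
  exact div_ne_zero (ofNatPoly_ne_zero h1) (ofNatPoly_ne_zero h2)

variable {P : Type*} [CommGroup P] [AddCommSemigroup P] [LeftDistribClass P]

/-- `P ∪ {0}` is a commutative semiring. -/
abbrev withZeroCommSemiring (P : Type*) [CommGroup P] [AddCommSemigroup P] [LeftDistribClass P] :
    CommSemiring (WithZero P) :=
  { (inferInstance : AddCommMonoid (WithZero P)),
    (inferInstance : CommMonoidWithZero (WithZero P)) with
    left_distrib := mul_add
    right_distrib := fun a b c => by rw [mul_comm, mul_add, mul_comm c a, mul_comm c b] }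

attribute [local instance] withZeroCommSemiring

theorem natPolyEvalZero_eq_eval₂ (p : σ → P) (N : MvPolynomial σ ℕ) :
    natPolyEvalZero p N =
      MvPolynomial.eval₂ (Nat.castRingHom (WithZero P)) (fun i => (p i : WithZero P)) N := by
  rw [natPolyEvalZero, MvPolynomial.eval₂_eq]
  refine Finset.sum_congr rfl fun m _ => ?_
  rw [nsmul_eq_mul, Nat.coe_castRingHom, Finsupp.prod]
  congr 1
  rw [← WithZero.coeMonoidHom_apply, map_prod]
  simp

theorem withZero_add_ne_zero {P : Type*} [AddCommSemigroup P] {a b : WithZero P} (h : a ≠ 0) : a + b ≠ 0 := by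
  induction a with
  | zero => exact absurd rfl h
  | coe a =>
    induction b with
    | zero => simp
    | coe b =>
      rw [← WithZero.coe_add]
      exact WithZero.coe_ne_zero

theorem natPolyEvalZero_ne_zero {P : Type*} [CommGroup P] [AddCommSemigroup P] (p : σ → P)
    {N : MvPolynomial σ ℕ} (h : N ≠ 0) :
    natPolyEvalZero p N ≠ 0 := by
  have hs : N.support.Nonempty := by simpa [Finset.nonempty_iff_ne_empty] using h
  refine Finset.sum_induction_nonempty _ (· ≠ 0) (fun a b ha _ => withZero_add_ne_zero ha) hs ?_
  intro m hm
  obtain ⟨k, hk⟩ := Nat.exists_eq_succ_of_ne_zero (MvPolynomial.mem_support_iff.mp hm)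
  rw [hk, succ_nsmul, add_comm]
  exact withZero_add_ne_zero WithZero.coe_ne_zero

theorem coe_natPolyEval (p : σ → P) {N : MvPolynomial σ ℕ} (h : N ≠ 0) :
    ((natPolyEval p N : P) : WithZero P) =
      MvPolynomial.eval₂ (Nat.castRingHom (WithZero P)) (fun i => (p i : WithZero P)) N := by
  rw [natPolyEval, dif_pos (natPolyEvalZero_ne_zero p h), WithZero.coe_unzero,
    natPolyEvalZero_eq_eval₂]

theorem natPolyEval_mul (p : σ → P) {N M : MvPolynomial σ ℕ} (hN : N ≠ 0) (hM : M ≠ 0) :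
    natPolyEval p (N * M) = natPolyEval p N * natPolyEval p M := by
  rw [← WithZero.coe_inj, WithZero.coe_mul, coe_natPolyEval p hN, coe_natPolyEval p hM,
    coe_natPolyEval p (mul_ne_zero hN hM), MvPolynomial.eval₂_mul]

theorem natPoly_add_ne_zero {N M : MvPolynomial σ ℕ} (hN : N ≠ 0) : N + M ≠ 0 := by
  intro h
  obtain ⟨m, hm⟩ := MvPolynomial.ne_zero_iff.mp hN
  have := congrArg (MvPolynomial.coeff m) h
  rw [MvPolynomial.coeff_add, MvPolynomial.coeff_zero] at this
  omega

theorem natPolyEval_add (p : σ → P) {N M : MvPolynomial σ ℕ} (hN : N ≠ 0) (hM : M ≠ 0) :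
    natPolyEval p (N + M) = natPolyEval p N + natPolyEval p M := by
  rw [← WithZero.coe_inj, WithZero.coe_add, coe_natPolyEval p hN, coe_natPolyEval p hM,
    coe_natPolyEval p (natPoly_add_ne_zero hN), MvPolynomial.eval₂_add]

theorem natPolyEval_one (p : σ → P) : natPolyEval p (1 : MvPolynomial σ ℕ) = 1 := by
  rw [← WithZero.coe_inj, coe_natPolyEval p one_ne_zero, MvPolynomial.eval₂_one, WithZero.coe_one]

theorem natPolyEval_X (p : σ → P) (i : σ) :
    natPolyEval p (MvPolynomial.X i : MvPolynomial σ ℕ) = p i := by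
  rw [← WithZero.coe_inj, coe_natPolyEval p (MvPolynomial.X_ne_zero i), MvPolynomial.eval₂_X]

/-- The subtraction-free function `f` specializes to `v` at `p`. -/
def SpecializesTo (p : σ → P) (f : Rat σ) (v : P) : Prop :=
  ∃ N M : MvPolynomial σ ℕ, N ≠ 0 ∧ M ≠ 0 ∧ f = ofNatPoly N / ofNatPoly M ∧
    v = natPolyEval p N / natPolyEval p M

variable {p : σ → P} {f g : Rat σ} {v w : P}

theorem SpecializesTo.unique (hf : SpecializesTo p f v) (hg : SpecializesTo p f w) : v = w := by
  obtain ⟨N, M, hN, hM, rfl, rfl⟩ := hf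
  obtain ⟨N', M', hN', hM', h, rfl⟩ := hg
  rw [div_eq_div_iff (ofNatPoly_ne_zero hM) (ofNatPoly_ne_zero hM'), ← ofNatPoly_mul,
    ← ofNatPoly_mul] at h
  rw [div_eq_div_iff_mul_eq_mul, ← natPolyEval_mul p hN hM', ofNatPoly_injective h,
    natPolyEval_mul p hN' hM]

theorem SpecializesTo.isSubtractionFree {P : Type*} [CommGroup P] [AddCommSemigroup P]
    {p : σ → P} {v : P} (hf : SpecializesTo p f v) : IsSubtractionFree f := by
  obtain ⟨N, M, hN, hM, h, -⟩ := hf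
  exact ⟨(N, M), hN, hM, h⟩

theorem IsSubtractionFree.specializesTo {P : Type*} [CommGroup P] [AddCommSemigroup P]
    (h : IsSubtractionFree f) (p : σ → P) :
    SpecializesTo p f (specialize p f) := by
  rw [specialize, dif_pos h]
  exact ⟨_, _, h.choose_spec.1, h.choose_spec.2.1, h.choose_spec.2.2, rfl⟩

theorem SpecializesTo.specialize_eq (hf : SpecializesTo p f v) : specialize p f = v :=
  (hf.isSubtractionFree.specializesTo p).unique hf

theorem specializesTo_var (p : σ → P) (i : σ) : SpecializesTo p (var i) (p i) :=
  ⟨MvPolynomial.X i, 1, MvPolynomial.X_ne_zero i, one_ne_zero, by simp [ofNatPoly, var],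
    by rw [natPolyEval_X, natPolyEval_one, div_one]⟩

theorem isMulRel_specializesTo (p : σ → P) : IsMulRel (SpecializesTo p) where
  one := ⟨1, 1, one_ne_zero, one_ne_zero, by simp [ofNatPoly],
    by rw [natPolyEval_one, div_one]⟩
  mul := by
    rintro f g v w ⟨N, M, hN, hM, rfl, rfl⟩ ⟨N', M', hN', hM', rfl, rfl⟩
    refine ⟨N * N', M * M', mul_ne_zero hN hN', mul_ne_zero hM hM', ?_, ?_⟩
    · rw [ofNatPoly_mul, ofNatPoly_mul, div_mul_div_comm]
    · rw [natPolyEval_mul p hN hN', natPolyEval_mul p hM hM', div_mul_div_comm]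
  inv := by
    rintro f v ⟨N, M, hN, hM, rfl, rfl⟩
    exact ⟨M, N, hM, hN, by rw [inv_div], by rw [inv_div]⟩

theorem SpecializesTo.add (hf : SpecializesTo p f v) (hg : SpecializesTo p g w) :
    SpecializesTo p (f + g) (v + w) := by
  obtain ⟨N, M, hN, hM, rfl, rfl⟩ := hf
  obtain ⟨N', M', hN', hM', rfl, rfl⟩ := hg
  refine ⟨N * M' + M * N', M * M', natPoly_add_ne_zero (mul_ne_zero hN hM'), mul_ne_zero hM hM',
    ?_, ?_⟩
  · rw [div_add_div _ _ (ofNatPoly_ne_zero hM) (ofNatPoly_ne_zero hM')]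
    simp only [ofNatPoly_mul, ofNatPoly_add]
  · rw [natPolyEval_add p (mul_ne_zero hN hM') (mul_ne_zero hM hN'), natPolyEval_mul p hN hM',
      natPolyEval_mul p hM hN', natPolyEval_mul p hM hM', eq_div_iff_mul_eq',
      mul_comm, mul_add]
    congr 1
    · rw [mul_div_assoc', div_eq_iff_eq_mul]
      ac_rfl
    · rw [mul_div_assoc', div_eq_iff_eq_mul]
      ac_rfl

end SubtractionFree

/-! ### Mutation of `ŷ`-like monomials -/

section Mutation

variable {n : ℕ}

/-- Mutation of an exchange matrix with exchange degree `d` in direction `k`. -/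
def mutateB (b : Matrix (Fin n) (Fin n) ℤ) (d : ℕ) (k : Fin n) : Matrix (Fin n) (Fin n) ℤ :=
  Matrix.of fun i j => if i = k ∨ j = k then -b i j
    else b i j + max (b i k) 0 * d * b k j + b i k * d * max (-b k j) 0

/-- Mutation of a matrix of `c`-vectors in direction `k`. -/
def mutateC (c b : Matrix (Fin n) (Fin n) ℤ) (d : ℕ) (k : Fin n) : Matrix (Fin n) (Fin n) ℤ :=
  Matrix.of fun i j => if j = k then -c i k
    else c i j + d * c i k * max (b k j) 0 + b k j * d * max (-c i k) 0

theorem IsSkewSymmetrizable.apply_self {b : Matrix (Fin n) (Fin n) ℤ}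
    (h : IsSkewSymmetrizable b) (k : Fin n) : b k k = 0 := by
  obtain ⟨s, hs, h⟩ := h
  have h1 := h k k
  have : s k * b k k = 0 := by linarith
  exact (mul_eq_zero.mp this).resolve_left (hs k).ne'

theorem IsSkewSymmetrizable.mutateB {b : Matrix (Fin n) (Fin n) ℤ} (h : IsSkewSymmetrizable b)
    (d : ℕ) (k : Fin n) : IsSkewSymmetrizable (mutateB b d k) := by
  obtain ⟨s, hs, h⟩ := h
  refine ⟨s, hs, fun i j => ?_⟩
  by_cases hik : i = k
  · simp [ClusterAlg.mutateB, hik, h k j]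
  by_cases hjk : j = k
  · simp [ClusterAlg.mutateB, hjk, h i k]
  simp only [ClusterAlg.mutateB, Matrix.of_apply, hik, hjk, or_self, if_false]
  have m1 : s i * max (b i k) 0 = s k * max (-b k i) 0 := by
    rw [mul_max_of_nonneg _ _ (hs i).le, mul_max_of_nonneg _ _ (hs k).le, h i k]
    simp
  have m2 : s j * max (b j k) 0 = s k * max (-b k j) 0 := by
    rw [mul_max_of_nonneg _ _ (hs j).le, mul_max_of_nonneg _ _ (hs k).le, h j k]
    simp
  linear_combination h i j + d * b k j * m1 + d * b k i * m2 + d * max (-b k j) 0 * h i k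
    + d * max (-b k i) 0 * h j k

variable {A : Type*} [AddCommGroup A]

/-- If the `f_i` undergo an exchange relation with right factor `w`, then the linear combinations
`∑ c_{ij} a_i + ∑ b_{ij} f_i` mutate like coefficients (additive form). -/
theorem sum_mutate_eq (a f : Fin n → A) (c b : Matrix (Fin n) (Fin n) ℤ) (d : ℕ) (k : Fin n)
    (hb : b k k = 0) (w : A) (j : Fin n) :
    (∑ i, mutateC c b d k i j • a i) + ∑ i, mutateB b d k i j •
      Function.update f k (-f k + d • ((∑ i, max (-c i k) 0 • a i) + ∑ i, max (-b i k) 0 • f i)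
        + w) i =
    if j = k then -((∑ i, c i k • a i) + ∑ i, b i k • f i)
    else ((∑ i, c i j • a i) + ∑ i, b i j • f i)
      + max (b k j) 0 • (d • ((∑ i, c i k • a i) + ∑ i, b i k • f i)) + (-b k j) • w := by
  set a' := ∑ i, max (-c i k) 0 • a i with ha'
  set f' := ∑ i, max (-b i k) 0 • f i with hf'
  have hupd : ∀ i, Function.update f k (-f k + d • (a' + f') + w) i =
      f i + if i = k then -(2 : ℤ) • f k + d • (a' + f') + w else 0 := by
    intro i
    by_cases hi : i = k
    · subst hi
      simp only [Function.update_self, if_true]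
      module
    · simp [hi]
  simp only [hupd]
  simp only [smul_add, Finset.sum_add_distrib, smul_ite, smul_zero, Finset.sum_ite_eq',
    Finset.mem_univ, if_true]
  by_cases hj : j = k
  · subst hj
    simp [mutateC, mutateB, hb]
    abel
  · simp only [hj, if_false]
    have hbk : mutateB b d k k j = -b k j := by simp [mutateB]
    have e1 : ∑ i, mutateC c b d k i j • a i = (∑ i, c i j • a i)
        + (d * max (b k j) 0) • (∑ i, c i k • a i) + (b k j * d) • a' := by
      simp only [ha', Finset.smul_sum, ← Finset.sum_add_distrib, mutateC, Matrix.of_apply, hj,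
        if_false]
      refine Finset.sum_congr rfl fun i _ => ?_
      module
    have e2 : ∑ i, mutateB b d k i j • f i = (∑ i, b i j • f i)
        + (d * max (b k j) 0) • (∑ i, b i k • f i) + (d * b k j) • f'
        - (2 * b k j) • f k := by
      have e3 : (2 * b k j) • f k = ∑ i, if i = k then (2 * b k j) • f i else 0 := by simp
      rw [e3, hf']
      simp only [Finset.smul_sum, ← Finset.sum_add_distrib, ← Finset.sum_sub_distrib]
      refine Finset.sum_congr rfl fun i _ => ?_
      by_cases hi : i = k
      · subst hi
        simp only [mutateB, Matrix.of_apply, true_or, if_true, hb, neg_zero, max_self]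
        module
      · simp only [mutateB, Matrix.of_apply, hi, hj, or_self, if_false]
        have p1 : max (b i k) 0 = b i k + max (-b i k) 0 := by grind
        have p2 : max (-b k j) 0 = max (b k j) 0 - b k j := by grind
        rw [p1, p2]
        module
    rw [hbk, e1, e2]
    module

/-- The monomial `∏ a_i ^ c_{ij} ∏ f_i ^ b_{ij}`. -/
def coeffMonomial {A : Type*} [DivisionCommMonoid A] (a f : Fin n → A)
    (c b : Matrix (Fin n) (Fin n) ℤ) (j : Fin n) : A :=
  (∏ i, a i ^ c i j) * ∏ i, f i ^ b i j

/-- The result `f_k⁻¹ (∏ a_i ^ [-c_{ik}]_+ ∏ f_i ^ [-b_{ik}]_+) ^ d w` of an exchange relation. -/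
def exchange {A : Type*} [DivisionCommMonoid A] (a f : Fin n → A)
    (c b : Matrix (Fin n) (Fin n) ℤ) (d : ℕ) (k : Fin n) (w : A) : A :=
  (f k)⁻¹ * ((∏ i, a i ^ max (-c i k) 0) * ∏ i, f i ^ max (-b i k) 0) ^ d * w

/-- If the `f_i` undergo an exchange relation with right factor `w`, then the monomials
`∏ a_i ^ c_{ij} ∏ f_i ^ b_{ij}` mutate like coefficients. -/
theorem coeffMonomial_exchange {A : Type*} [CommGroup A] (a f : Fin n → A)
    (c b : Matrix (Fin n) (Fin n) ℤ) (d : ℕ) (k : Fin n) (hb : b k k = 0) (w : A) (j : Fin n) :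
    coeffMonomial a (Function.update f k (exchange a f c b d k w)) (mutateC c b d k)
      (mutateB b d k) j =
    if j = k then (coeffMonomial a f c b k)⁻¹
    else coeffMonomial a f c b j * (coeffMonomial a f c b k ^ d) ^ max (b k j) 0 *
      w ^ (-b k j) :=
  sum_mutate_eq (A := Additive A) a f c b d k hb w j

section Divisible

variable {A : Type*} [DivisionCommMonoid A] (a a' f f' : Fin n → A)
  (c b : Matrix (Fin n) (Fin n) ℤ)

theorem coeffMonomial_mul (j : Fin n) : coeffMonomial (a * a') (f * f') c b j =
    coeffMonomial a f c b j * coeffMonomial a' f' c b j := by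
  simp only [coeffMonomial, Pi.mul_apply, mul_zpow, Finset.prod_mul_distrib]
  ac_rfl

theorem coeffMonomial_div (j : Fin n) : coeffMonomial (a / a') (f / f') c b j =
    coeffMonomial a f c b j / coeffMonomial a' f' c b j := by
  simp only [coeffMonomial, Pi.div_apply, div_zpow, Finset.prod_div_distrib, div_mul_div_comm]

theorem exchange_mul (d : ℕ) (k : Fin n) (w w' : A) :
    exchange (a * a') (f * f') c b d k (w * w') =
      exchange a f c b d k w * exchange a' f' c b d k w' := by
  simp only [exchange, Pi.mul_apply, mul_zpow, Finset.prod_mul_distrib, mul_inv, mul_pow]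
  ac_rfl

theorem exchange_div (d : ℕ) (k : Fin n) (w w' : A) :
    exchange (a / a') (f / f') c b d k (w / w') =
      exchange a f c b d k w / exchange a' f' c b d k w' := by
  simp only [exchange, Pi.div_apply, div_zpow, Finset.prod_div_distrib, inv_div,
    mul_div_mul_comm, inv_div_inv, ← div_pow]

variable {a₀ e f₀ p : Fin n → A} {a f} in
theorem coeffMonomial_one_eq (h : a₀ * (a / e) = 1) (j : Fin n) :
    coeffMonomial 1 (f₀ * (f / p)) c b j =
      coeffMonomial a₀ f₀ c b j * (coeffMonomial a f c b j / coeffMonomial e p c b j) := by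
  rw [← h, coeffMonomial_mul, coeffMonomial_div]

variable {a₀ e f₀ p : Fin n → A} {a f} in
theorem exchange_one_eq (h : a₀ * (a / e) = 1) (d : ℕ) (k : Fin n) (w w' : A) :
    exchange 1 (f₀ * (f / p)) c b d k (w / w') =
      exchange a₀ f₀ c b d k 1 * (exchange a f c b d k w / exchange e p c b d k w') := by
  rw [← h, ← exchange_div, ← exchange_mul, one_mul]

theorem IsMulRel.coeffMonomial {K : Type*} [DivisionCommMonoid K] {R : K → A → Prop}
    (hR : IsMulRel R) {x y : Fin n → K} {a f : Fin n → A} (hx : ∀ i, R (x i) (a i))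
    (hy : ∀ i, R (y i) (f i)) (j : Fin n) :
    R (coeffMonomial x y c b j) (coeffMonomial a f c b j) :=
  hR.mul (hR.prod _ fun i => hR.zpow (hx i) _) (hR.prod _ fun i => hR.zpow (hy i) _)

theorem IsMulRel.exchange {K : Type*} [DivisionCommMonoid K] {R : K → A → Prop}
    (hR : IsMulRel R) {x y : Fin n → K} {a f : Fin n → A} (hx : ∀ i, R (x i) (a i))
    (hy : ∀ i, R (y i) (f i)) (d : ℕ) (k : Fin n) {v : K} {w : A} (hw : R v w) :
    R (exchange x y c b d k v) (exchange a f c b d k w) :=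
  hR.mul (hR.mul (hR.inv (hy k)) (hR.pow (hR.mul (hR.prod _ fun i => hR.zpow (hx i) _)
    (hR.prod _ fun i => hR.zpow (hy i) _)) d)) hw

end Divisible

end Mutation

/-! ### Tropical exponents -/

namespace Trop

variable {σ : Type*}

theorem exponent_mul (a b : Trop σ) : exponent (a * b) = exponent a + exponent b := rfl

theorem exponent_inv (a : Trop σ) : exponent a⁻¹ = -exponent a := rfl

theorem exponent_pow (a : Trop σ) (m : ℕ) : exponent (a ^ m) = m • exponent a := rfl

theorem exponent_zpow (a : Trop σ) (m : ℤ) : exponent (a ^ m) = m • exponent a := rfl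

theorem exponent_gen (i : σ) : exponent (gen i) = Finsupp.single i 1 := rfl

theorem exponent_add_apply (a b : Trop σ) (i : σ) :
    exponent (a + b) i = min (exponent a i) (exponent b i) := rfl

theorem exponent_auxSum_le (f : ℕ → Trop σ) (q : σ) (m : ℕ) {s : ℕ} (hs : s ≤ m) :
    exponent (auxSum f m) q ≤ exponent (f s) q := by
  induction m with
  | zero => rw [Nat.le_zero.mp hs, auxSum]
  | succ m ih =>
    rw [auxSum, exponent_add_apply]
    rcases Nat.le_succ_iff.mp hs with h | h
    · exact (min_le_left _ _).trans (ih h)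
    · rw [h]
      exact min_le_right _ _

theorem le_exponent_auxSum (f : ℕ → Trop σ) (q : σ) (m : ℕ) {c : ℤ}
    (h : ∀ s ≤ m, c ≤ exponent (f s) q) : c ≤ exponent (auxSum f m) q := by
  induction m with
  | zero => exact h 0 le_rfl
  | succ m ih =>
    rw [auxSum, exponent_add_apply]
    exact le_min (ih fun s hs => h s (hs.trans m.le_succ)) (h _ le_rfl)

variable {L : Type*} [Field L] (v : σ → L) (hv : ∀ i, v i ≠ 0)

theorem toField_gen (i : σ) : toField v hv (gen i) = v i := by
  change (exponent (gen i)).prod (fun i m => v i ^ m) = v i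
  rw [exponent_gen, Finsupp.prod_single_index (zpow_zero _), zpow_one]

theorem toField_eq_prod_inl {n : ℕ} {τ : Type*} (v : Fin n ⊕ τ → L) (hv : ∀ i, v i ≠ 0)
    (a : Trop (Fin n ⊕ τ)) (h : ∀ q, exponent a (Sum.inr q) = 0) :
    toField v hv a = ∏ i, v (Sum.inl i) ^ exponent a (Sum.inl i) := by
  have hs : (exponent a).support ⊆ Finset.univ.map Function.Embedding.inl := by
    rintro (i | q) hi
    · simp
    · exact absurd (h q) (Finsupp.mem_support_iff.mp hi)
  change (exponent a).prod (fun i m => v i ^ m) = _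
  rw [Finsupp.prod_of_support_subset _ hs _ (fun i _ => zpow_zero _), Finset.prod_map]
  rfl

end Trop

/-! ### Values of subtraction-free functions on a positive cone -/

section Cone

/-- A subset of a field closed under sums, products and inverses and avoiding zero. -/
structure IsPositiveCone {L : Type*} [Field L] (C : Set L) : Prop where
  zero_notMem : 0 ∉ C
  one_mem : 1 ∈ C
  add_mem : ∀ {a b}, a ∈ C → b ∈ C → a + b ∈ C
  mul_mem : ∀ {a b}, a ∈ C → b ∈ C → a * b ∈ C
  inv_mem : ∀ {a}, a ∈ C → a⁻¹ ∈ C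

variable {L : Type*} [Field L] {C : Set L}

theorem IsPositiveCone.isMulRel (hC : IsPositiveCone C) :
    IsMulRel fun (a : L) (_ : Unit) => a ∈ C where
  one := hC.one_mem
  mul := hC.mul_mem
  inv := hC.inv_mem

theorem IsPositiveCone.aeval_mem (hC : IsPositiveCone C) {σ : Type*} {a : σ → L}
    (ha : ∀ i, a i ∈ C) {N : MvPolynomial σ ℕ} (hN : N ≠ 0) :
    MvPolynomial.aeval a (MvPolynomial.map (Nat.castRingHom ℤ) N) ∈ C := by
  rw [MvPolynomial.aeval_def, MvPolynomial.eval₂_map, MvPolynomial.eval₂_eq]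
  have hs : N.support.Nonempty := by simpa [Finset.nonempty_iff_ne_empty] using hN
  refine Finset.sum_induction_nonempty _ (· ∈ C) (fun a b => hC.add_mem) hs ?_
  intro m hm
  refine hC.mul_mem ?_ (hC.isMulRel.prod (a := fun _ => ()) _
    fun i => hC.isMulRel.pow (a := ()) (ha i) _)
  obtain ⟨k, hk⟩ := Nat.exists_eq_succ_of_ne_zero (MvPolynomial.mem_support_iff.mp hm)
  rw [hk, eq_natCast]
  clear hk
  induction k with
  | zero => simpa using hC.one_mem
  | succ k ih =>
    rw [Nat.cast_succ]
    exact hC.add_mem ih hC.one_mem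

theorem IsPositiveCone.evalsToUnit (hC : IsPositiveCone C) {σ : Type*} {a : σ → L}
    (ha : ∀ i, a i ∈ C) {f : Rat σ} (hf : IsSubtractionFree f) :
    EvalsToUnit a f (ratEval a f) := by
  obtain ⟨⟨N, M⟩, hN, hM, rfl⟩ := hf
  have h0 : ∀ {x}, x ∈ C → x ≠ 0 := fun hx h => hC.zero_notMem (h ▸ hx)
  have h : EvalsTo a (ofNatPoly N / ofNatPoly M) _ :=
    ⟨_, _, h0 (hC.aeval_mem ha hM), rfl, rfl⟩
  rw [h.ratEval_eq]
  exact ⟨h, div_ne_zero (h0 (hC.aeval_mem ha hN)) (h0 (hC.aeval_mem ha hM))⟩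

/-- The quotients of elements of a subring `φ(R)` on which a homomorphism `R → ℤ` is positive form
a positive cone. -/
theorem isPositiveCone_of_ringHom {R : Type*} [CommRing R] (φ : R →+* L)
    (hφ : Function.Injective φ) (ε : R →+* ℤ) :
    IsPositiveCone {a : L | ∃ N M : R, 0 < ε N ∧ 0 < ε M ∧ a = φ N / φ M} := by
  have h0 : ∀ {N}, 0 < ε N → φ N ≠ 0 := by
    intro N hN h
    rw [map_eq_zero_iff φ hφ] at h
    rw [h, map_zero] at hN
    exact hN.false
  constructor
  · rintro ⟨N, M, hN, hM, h⟩
    exact div_ne_zero (h0 hN) (h0 hM) h.symm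
  · exact ⟨1, 1, by simp, by simp, by simp⟩
  · rintro _ _ ⟨N, M, hN, hM, rfl⟩ ⟨N', M', hN', hM', rfl⟩
    refine ⟨N * M' + M * N', M * M', ?_, ?_, ?_⟩
    · rw [map_add, map_mul, map_mul]
      positivity
    · rw [map_mul]
      positivity
    · rw [div_add_div _ _ (h0 hM) (h0 hM')]
      simp only [map_mul, map_add]
  · rintro _ _ ⟨N, M, hN, hM, rfl⟩ ⟨N', M', hN', hM', rfl⟩
    refine ⟨N * N', M * M', ?_, ?_, ?_⟩
    · rw [map_mul]
      positivity
    · rw [map_mul]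
      positivity
    · rw [map_mul, map_mul, div_mul_div_comm]
  · rintro _ ⟨N, M, hN, hM, rfl⟩
    exact ⟨M, N, hM, hN, by rw [inv_div]⟩

variable {n : ℕ} {P : Type*} [CommGroup P] [AddCommSemigroup P] [LeftDistribClass P]
  [Algebra (QP P) L]

theorem coeffHom_ne_zero (p : P) : coeffHom P L p ≠ 0 :=
  ((Group.isUnit p).map (coeffHom P L)).ne_zero

/-- Over algebraically independent variables there is a positive cone containing the variables and
the coefficients. -/
theorem exists_isPositiveCone {x : Fin n → L} (hx : AlgebraicIndependent (QP P) x) :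
    ∃ C : Set L, IsPositiveCone C ∧ (∀ i, x i ∈ C) ∧ ∀ p, coeffHom P L p ∈ C := by
  let φ : MvPolynomial (Fin n) (MonoidAlgebra ℤ P) →+* L :=
    (MvPolynomial.aeval (R := QP P) x).toRingHom.comp
      (MvPolynomial.map (algebraMap (MonoidAlgebra ℤ P) (QP P)))
  have hφ : Function.Injective φ :=
    (algebraicIndependent_iff_injective_aeval.mp hx).comp (MvPolynomial.map_injective _ (IsFractionRing.injective (MonoidAlgebra ℤ P) (QP P)))
  let ε : MvPolynomial (Fin n) (MonoidAlgebra ℤ P) →+* ℤ :=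
    MvPolynomial.eval₂Hom (MonoidAlgebra.lift ℤ ℤ P (1 : P →* ℤ)).toRingHom fun _ => 1
  refine ⟨_, isPositiveCone_of_ringHom φ hφ ε, fun i => ⟨MvPolynomial.X i, 1, ?_, ?_, ?_⟩,
    fun p => ⟨MvPolynomial.C (MonoidAlgebra.of ℤ P p), 1, ?_, ?_, ?_⟩⟩
  · simp [ε]
  · simp
  · simp [φ]
  · simp [ε]
  · simp
  · simp [φ, coeffHom]

theorem GenSeed.IsGenSeed.exists_isPositiveCone {S : GenSeed n P L} (hS : S.IsGenSeed) :
    ∃ C : Set L, IsPositiveCone C ∧ ∀ k, S.hat k ∈ C := by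
  obtain ⟨C, hC, hx, hp⟩ := ClusterAlg.exists_isPositiveCone hS.algebraicIndependent
  refine ⟨C, hC, fun k => hC.mul_mem (hp _) ?_⟩
  exact hC.isMulRel.prod (a := fun _ => ()) _
    fun i => hC.isMulRel.zpow (a := ()) (hx i) _

end Cone

/-! ### The formal pattern -/

section FormalPattern

variable {n : ℕ} {B : Matrix (Fin n) (Fin n) ℤ} {d : Fin n → ℕ}

/-- The exponents of the `y_i` in the coefficients of a formal generalized seed. -/
def GenSeed.cMatrix (S : GenSeed n (Trop (YZ d)) (Rat (XYZ d))) : Matrix (Fin n) (Fin n) ℤ :=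
  Matrix.of fun i j => (S.y j).exponent (Sum.inl i)

/-- The embedding of `Trop(y, z)` into `ℚ(y, z)`. -/
def yzHom (d : Fin n → ℕ) : Trop (YZ d) →* Rat (YZ d) :=
  Trop.toField var var_ne_zero

/-- Properties of the coefficients of the formal generalized seeds. -/
structure IsFormalCoeff (S : GenSeed n (Trop (YZ d)) (Rat (XYZ d))) : Prop where
  d_pos : ∀ k, 0 < S.d k
  y_inr : ∀ j q, (S.y j).exponent (Sum.inr q) = 0
  z_end : ∀ k s, s = 0 ∨ s = S.d k → S.z k s = 1
  z_mid : ∀ k s, 0 < s → s < S.d k → ∃ q, S.z k s = Trop.gen (Sum.inr q)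

namespace IsFormalCoeff

variable {S : GenSeed n (Trop (YZ d)) (Rat (XYZ d))} (h : IsFormalCoeff S) (k : Fin n)

include h

theorem exponent_z_inl {s : ℕ} (hs : s ≤ S.d k) (i : Fin n) :
    (S.z k s).exponent (Sum.inl i) = 0 := by
  by_cases h1 : s = 0 ∨ s = S.d k
  · rw [h.z_end k s h1]
    rfl
  · obtain ⟨q, hq⟩ := h.z_mid k s (by omega) (by omega)
    rw [hq, Trop.exponent_gen]
    simp

theorem exponent_z_inr_nonneg {s : ℕ} (hs : s ≤ S.d k) (q : ZIndex d) :
    0 ≤ (S.z k s).exponent (Sum.inr q) := by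
  classical
  by_cases h1 : s = 0 ∨ s = S.d k
  · rw [h.z_end k s h1]
    rfl
  · obtain ⟨q', hq⟩ := h.z_mid k s (by omega) (by omega)
    rw [hq, Trop.exponent_gen, Finsupp.single_apply]
    split_ifs <;> simp

theorem exponent_auxSum_inl (i : Fin n) :
    (auxSum (fun s => S.z k s * S.y k ^ s) (S.d k)).exponent (Sum.inl i) =
      -(S.d k * max (-S.cMatrix i k) 0) := by
  have term : ∀ s ≤ S.d k, (S.z k s * S.y k ^ s).exponent (Sum.inl i) = s * S.cMatrix i k := by
    intro s hs
    rw [Trop.exponent_mul, Trop.exponent_pow, Finsupp.add_apply, h.exponent_z_inl k hs]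
    simp [GenSeed.cMatrix]
  apply le_antisymm
  · rcases le_total 0 (S.cMatrix i k) with hc | hc
    · refine (Trop.exponent_auxSum_le _ _ _ (Nat.zero_le _)).trans ?_
      rw [term 0 (Nat.zero_le _), max_eq_right (by omega)]
      simp
    · refine (Trop.exponent_auxSum_le _ _ _ le_rfl).trans ?_
      rw [term _ le_rfl, max_eq_left (by omega)]
      simp
  · refine Trop.le_exponent_auxSum _ _ _ fun s hs => ?_
    rw [term s hs]
    have hs' : (s : ℤ) ≤ S.d k := by exact_mod_cast hs
    rcases le_total 0 (S.cMatrix i k) with hc | hc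
    · rw [max_eq_right (by omega)]
      simp only [mul_zero, neg_zero]
      positivity
    · rw [max_eq_left (by omega)]
      nlinarith

theorem exponent_auxSum_inr (q : ZIndex d) :
    (auxSum (fun s => S.z k s * S.y k ^ s) (S.d k)).exponent (Sum.inr q) = 0 := by
  have term : ∀ s, (S.z k s * S.y k ^ s).exponent (Sum.inr q) =
      (S.z k s).exponent (Sum.inr q) := by
    intro s
    rw [Trop.exponent_mul, Trop.exponent_pow, Finsupp.add_apply, Finsupp.smul_apply,
      h.y_inr k q, smul_zero, add_zero]
  apply le_antisymm
  · refine (Trop.exponent_auxSum_le _ _ _ (Nat.zero_le _)).trans ?_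
    rw [term 0, h.z_end k 0 (Or.inl rfl)]
    rfl
  · refine Trop.le_exponent_auxSum _ _ _ fun s hs => ?_
    rw [term s]
    exact h.exponent_z_inr_nonneg k hs q

theorem formalHom_y : formalHom d (S.y k) =
    ∏ i, var (Sum.inr (Sum.inl i)) ^ S.cMatrix i k :=
  Trop.toField_eq_prod_inl _ _ _ (h.y_inr k)

theorem formalHom_auxSum :
    formalHom d (auxSum (fun s => S.z k s * S.y k ^ s) (S.d k)) =
      ((∏ i, var (Sum.inr (Sum.inl i)) ^ max (-S.cMatrix i k) 0) ^ S.d k)⁻¹ := by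
  rw [formalHom, Trop.toField_eq_prod_inl _ _ _ (h.exponent_auxSum_inr k), ← Finset.prod_pow,
    ← Finset.prod_inv_distrib]
  refine Finset.prod_congr rfl fun i _ => ?_
  rw [h.exponent_auxSum_inl, zpow_neg, mul_comm, zpow_mul, zpow_natCast]

theorem hatY_eq : hatY (formalHom d) S.x S.y S.B k =
    coeffMonomial (fun i => var (Sum.inr (Sum.inl i))) S.x S.cMatrix S.B k := by
  rw [hatY, h.formalHom_y, coeffMonomial]

theorem mutate_x : (S.mutate (formalHom d) k).x = Function.update S.x k
    (exchange (fun i => var (Sum.inr (Sum.inl i))) S.x S.cMatrix S.B (S.d k) k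
      (∑ s ∈ Finset.range (S.d k + 1), formalHom d (S.z k s) *
        coeffMonomial (fun i => var (Sum.inr (Sum.inl i))) S.x S.cMatrix S.B k ^ s)) := by
  funext i
  by_cases hi : i = k
  · subst hi
    simp only [GenSeed.mutate, if_true, Function.update_self]
    rw [h.formalHom_auxSum, h.hatY_eq, div_inv_eq_mul, exchange, mul_pow]
    ring
  · simp [GenSeed.mutate, hi]

theorem mutate : IsFormalCoeff (S.mutate (formalHom d) k) where
  d_pos := h.d_pos
  y_inr j q := by
    by_cases hj : j = k
    · simp [GenSeed.mutate, hj, Trop.exponent_inv, h.y_inr]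
    · simp [GenSeed.mutate, hj, Trop.exponent_mul, Trop.exponent_zpow, Trop.exponent_pow,
        Trop.exponent_inv, h.y_inr, h.exponent_auxSum_inr]
  z_end i s hs := by
    by_cases hi : i = k
    · subst hi
      simp only [GenSeed.mutate, if_true] at hs ⊢
      exact h.z_end _ _ (by omega)
    · simp only [GenSeed.mutate, hi, if_false] at hs ⊢
      exact h.z_end _ _ hs
  z_mid i s h0 h1 := by
    by_cases hi : i = k
    · subst hi
      simp only [GenSeed.mutate, if_true] at h1 ⊢
      exact h.z_mid _ _ (by omega) (by omega)
    · simp only [GenSeed.mutate, hi, if_false] at h1 ⊢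
      exact h.z_mid _ _ h0 h1

theorem cMatrix_mutate :
    (S.mutate (formalHom d) k).cMatrix = mutateC S.cMatrix S.B (S.d k) k := by
  ext i j
  by_cases hj : j = k
  · simp [GenSeed.cMatrix, mutateC, GenSeed.mutate, hj, Trop.exponent_inv]
  · have e := h.exponent_auxSum_inl k i
    simp only [GenSeed.cMatrix, Matrix.of_apply] at e
    simp only [GenSeed.cMatrix, mutateC, GenSeed.mutate, hj, Trop.exponent_mul,
      Trop.exponent_zpow, Trop.exponent_pow, Finsupp.add_apply, Finsupp.smul_apply, e,
      Matrix.of_apply, if_false, smul_eq_mul, nsmul_eq_mul]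
    ring

end IsFormalCoeff

/-- The sum `Z_k(u)` at `z = 0` is `1 + u ^ d_k`. -/
theorem IsFormalCoeff.evalsTo_sum {S : GenSeed n (Trop (YZ d)) (Rat (XYZ d))}
    (h : IsFormalCoeff S) (k : Fin n) {U : Rat (YZ d)} {u : Rat (Fin n)}
    (hU : EvalsToUnit (zZero d) U u) :
    EvalsTo (zZero d) (∑ s ∈ Finset.range (S.d k + 1), yzHom d (S.z k s) * U ^ s)
      (1 + u ^ S.d k) := by
  have e : (1 : Rat (Fin n)) + u ^ S.d k =
      ∑ s ∈ Finset.range (S.d k + 1), (if s = 0 ∨ s = S.d k then 1 else 0) * u ^ s := by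
    obtain ⟨m, hm⟩ := Nat.exists_eq_succ_of_ne_zero (h.d_pos k).ne'
    rw [hm, Finset.sum_range_succ, Finset.sum_range_succ', Finset.sum_eq_zero]
    · simp
    · intro s hs
      rw [Finset.mem_range] at hs
      rw [if_neg (by omega), zero_mul]
  rw [e]
  refine EvalsTo.sum _ fun s hs => EvalsTo.mul ?_ ((isMulRel_evalsToUnit _).pow hU s).1
  rw [Finset.mem_range] at hs
  split_ifs with h1
  · rw [h.z_end k s h1, map_one]
    exact evalsTo_one _
  · obtain ⟨q, hq⟩ := h.z_mid k s (by omega) (by omega)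
    rw [hq, yzHom, Trop.toField_gen]
    exact evalsTo_var (zZero d) (Sum.inr q)

/-- The formal generalized seed `S`, together with the degrees `g` of its cluster variables, their
values `F` at `x = 1` and the values `f` of `F` at `z = 0`. -/
structure IsFormalSeed (B : Matrix (Fin n) (Fin n) ℤ) (S : GenSeed n (Trop (YZ d)) (Rat (XYZ d)))
    (g : Fin n → Multiplicative (Fin n → ℤ)) (F : Fin n → Rat (YZ d)) (f : Fin n → Rat (Fin n)) :
    Prop where
  d_eq : S.d = d
  skew : IsSkewSymmetrizable S.B
  coeff : IsFormalCoeff S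
  hom : ∀ j, IsHomogeneousOfDegree (gDegree B d) (S.x j) (g j).toAdd
  evals_x : ∀ j, EvalsToUnit (xOne d) (S.x j) (F j)
  evals_F : ∀ j, EvalsToUnit (zZero d) (F j) (f j)
  subtractionFree : ∀ j, IsSubtractionFree (f j)
  degree_hat : ∀ j, coeffMonomial
    (fun i => Multiplicative.ofAdd (gDegree B d (Sum.inr (Sum.inl i)))) g S.cMatrix S.B j = 1

theorem isFormalSeed_formalSeed (hB : IsSkewSymmetrizable B) (hd : ∀ i, 0 < d i) :
    IsFormalSeed B (formalSeed B d) (fun j => Multiplicative.ofAdd (Pi.single j 1)) 1 1 where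
  d_eq := rfl
  skew := hB
  coeff :=
    { d_pos := hd
      y_inr := fun j q => by simp [formalSeed, Trop.exponent_gen]
      z_end := fun k s hs => dif_neg (by simp only [formalSeed] at hs; omega)
      z_mid := fun k s h0 h1 => ⟨⟨k, s, h0, h1⟩, dif_pos ⟨h0, h1⟩⟩ }
  hom j := isHomogeneousOfDegree_var (gDegree B d) (Sum.inl j)
  evals_x j := ⟨evalsTo_var (xOne d) (Sum.inl j), one_ne_zero⟩
  evals_F _ := (isMulRel_evalsToUnit _).one
  subtractionFree _ := ((isMulRel_specializesTo fun _ : Fin n => (1 : Trop Unit)).one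
    ).isSubtractionFree
  degree_hat j := by
    classical
    apply Multiplicative.toAdd.injective
    simp only [coeffMonomial, toAdd_mul, toAdd_prod, toAdd_zpow, toAdd_ofAdd, toAdd_one]
    funext l
    simp [formalSeed, GenSeed.cMatrix, Trop.exponent_gen, gDegree, Finsupp.single_apply,
      Pi.single_apply]

variable {S : GenSeed n (Trop (YZ d)) (Rat (XYZ d))} {g : Fin n → Multiplicative (Fin n → ℤ)}
  {F : Fin n → Rat (YZ d)} {f : Fin n → Rat (Fin n)}

theorem forall_update {ι α β : Type*} [DecidableEq ι] {R : α → β → Prop} {x : ι → α} {y : ι → β}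
    (h : ∀ j, R (x j) (y j)) {k : ι} {a : α} {b : β} (hab : R a b) (j : ι) :
    R (Function.update x k a j) (Function.update y k b j) := by
  by_cases hj : j = k
  · subst hj
    simpa using hab
  · simpa [hj] using h j

theorem IsFormalSeed.mutate (h : IsFormalSeed B S g F f) (k : Fin n) :
    IsFormalSeed B (S.mutate (formalHom d) k)
      (Function.update g k (exchange
        (fun i => Multiplicative.ofAdd (gDegree B d (Sum.inr (Sum.inl i)))) g S.cMatrix S.B
        (S.d k) k 1))
      (Function.update F k (exchange (fun i => var (Sum.inl i)) F S.cMatrix S.B (S.d k) k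
        (∑ s ∈ Finset.range (S.d k + 1), yzHom d (S.z k s) *
          coeffMonomial (fun i => var (Sum.inl i)) F S.cMatrix S.B k ^ s)))
      (Function.update f k (exchange var f S.cMatrix S.B (S.d k) k
        (1 + coeffMonomial var f S.cMatrix S.B k ^ S.d k))) := by
  have hz := isMulRel_evalsToUnit (zZero d)
  have hx := isMulRel_evalsToUnit (xOne d)
  have hs := isMulRel_specializesTo fun _ : Fin n => (1 : Trop Unit)
  have hg := isMulRel_isHomogeneousOfDegree (gDegree B d)
  have ay : ∀ i : Fin n, EvalsToUnit (xOne d) (var (Sum.inr (Sum.inl i))) (var (Sum.inl i)) :=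
    fun i => ⟨evalsTo_var (xOne d) _, var_ne_zero _⟩
  have az : ∀ i : Fin n, EvalsToUnit (zZero d) (var (Sum.inl i)) (var i) :=
    fun i => ⟨evalsTo_var (zZero d) _, var_ne_zero _⟩
  have hsf := fun j => (h.subtractionFree j).specializesTo fun _ => (1 : Trop Unit)
  have hm := hs.coeffMonomial S.cMatrix S.B (specializesTo_var _) hsf k
  have hw := hs.one.add (hs.pow hm (S.d k))
  have hWz := h.coeff.evalsTo_sum k (hz.coeffMonomial S.cMatrix S.B az h.evals_F k)
  have hW0 := hWz.ne_zero hw.isSubtractionFree.ne_zero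
  have hzhom : ∀ q, EvalsTo (xOne d) (formalHom d q) (yzHom d q) := fun q =>
    (hx.prod _ fun i => hx.zpow ⟨evalsTo_var (xOne d) (Sum.inr i), var_ne_zero i⟩ _).1
  have hWx : EvalsToUnit (xOne d) (∑ s ∈ Finset.range (S.d k + 1), formalHom d (S.z k s) *
        coeffMonomial (fun i => var (Sum.inr (Sum.inl i))) S.x S.cMatrix S.B k ^ s) _ :=
    ⟨EvalsTo.sum _ fun s _ => (hzhom (S.z k s)).mul
      (hx.pow (hx.coeffMonomial S.cMatrix S.B ay h.evals_x k) s).1, hW0⟩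
  have ag : ∀ i : Fin n, IsHomogeneousOfDegree (gDegree B d) (var (Sum.inr (Sum.inl i)))
      (Multiplicative.ofAdd (gDegree B d (Sum.inr (Sum.inl i)))).toAdd :=
    fun i => isHomogeneousOfDegree_var _ _
  have hWg : IsHomogeneousOfDegree (gDegree B d) (∑ s ∈ Finset.range (S.d k + 1),
      formalHom d (S.z k s) *
        coeffMonomial (fun i => var (Sum.inr (Sum.inl i))) S.x S.cMatrix S.B k ^ s)
      (1 : Multiplicative (Fin n → ℤ)).toAdd := by
    refine IsHomogeneousOfDegree.sum _ (fun s hs' => ?_) (hWx.1.ne_zero hWx.2)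
    have h1 := hg.pow (hg.coeffMonomial S.cMatrix S.B ag h.hom k) s
    rw [h.degree_hat, one_pow] at h1
    rw [← one_mul (1 : Multiplicative (Fin n → ℤ))]
    refine hg.mul ?_ h1
    rw [Finset.mem_range] at hs'
    by_cases h2 : s = 0 ∨ s = S.d k
    · rw [h.coeff.z_end k s h2, map_one]
      exact hg.one
    · obtain ⟨q, hq⟩ := h.coeff.z_mid k s (by omega) (by omega)
      rw [hq, formalHom, Trop.toField_gen]
      exact isHomogeneousOfDegree_var (gDegree B d) (Sum.inr (Sum.inr q))
  refine ⟨h.d_eq, h.skew.mutateB (S.d k) k, h.coeff.mutate k, ?_, ?_, ?_, ?_, ?_⟩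
  · rw [h.coeff.mutate_x k]
    exact forall_update (R := fun f (c : Multiplicative (Fin n → ℤ)) =>
      IsHomogeneousOfDegree (gDegree B d) f c.toAdd) h.hom
      (hg.exchange S.cMatrix S.B ag h.hom _ k hWg)
  · rw [h.coeff.mutate_x k]
    exact forall_update h.evals_x (hx.exchange S.cMatrix S.B ay h.evals_x _ k hWx)
  · exact forall_update h.evals_F (hz.exchange S.cMatrix S.B az h.evals_F _ k
      ⟨hWz, hw.isSubtractionFree.ne_zero⟩)
  · exact forall_update (R := fun f (_ : Unit) => IsSubtractionFree f) (y := fun _ => ())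
      (b := ()) h.subtractionFree
      (hs.exchange S.cMatrix S.B (specializesTo_var _) hsf _ k hw).isSubtractionFree
  · intro j
    rw [h.coeff.cMatrix_mutate]
    refine (coeffMonomial_exchange _ _ _ _ _ _ (h.skew.apply_self k) _ _).trans ?_
    simp only [h.degree_hat]
    simp

/-- The degree of the `X`-function `X^t_j`. -/
def gDegreeAt (B : Matrix (Fin n) (Fin n) ℤ) (d : Fin n → ℕ) (t : List (Fin n)) (j : Fin n) :
    Multiplicative (Fin n → ℤ) :=
  Multiplicative.ofAdd fun i => gVec B d t i j

theorem IsFormalSeed.eq {t : List (Fin n)} (h : IsFormalSeed B (formalAt B d t) g F f) :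
    gDegreeAt B d t = g ∧ Fpoly B d t = F ∧ FpolyZero B d t = f := by
  have hF : Fpoly B d t = F := funext fun j => (h.evals_x j).1.ratEval_eq
  refine ⟨?_, hF, ?_⟩
  · funext j
    apply Multiplicative.toAdd.injective
    funext i
    have hj : ∃ g, IsHomogeneousOfDegree (gDegree B d) (Xfun B d t j) g := ⟨_, h.hom j⟩
    change gVec B d t i j = _
    rw [gVec, dif_pos hj]
    exact congrFun (hj.choose_spec.unique (h.hom j)) i
  · funext j
    rw [FpolyZero, hF]
    exact (h.evals_F j).1.ratEval_eq

theorem isFormalSeed_formalAt (hB : IsSkewSymmetrizable B) (hd : ∀ i, 0 < d i)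
    (t : List (Fin n)) :
    IsFormalSeed B (formalAt B d t) (gDegreeAt B d t) (Fpoly B d t) (FpolyZero B d t) := by
  have key : ∃ g F f, IsFormalSeed B (formalAt B d t) g F f := by
    induction t with
    | nil => exact ⟨_, _, _, isFormalSeed_formalSeed hB hd⟩
    | cons k t ih =>
      obtain ⟨g, F, f, h⟩ := ih
      exact ⟨_, _, _, h.mutate k⟩
  obtain ⟨g, F, f, h⟩ := key
  obtain ⟨rfl, rfl, rfl⟩ := h.eq
  exact h

end FormalPattern

/-! ### The pattern at `z = 0` and the right companion -/

section AtZero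

variable {n : ℕ} {P L : Type*} [CommGroup P] [AddCommSemigroup P] [LeftDistribClass P]
  [Field L] [Algebra (QP P) L] {S : GenSeed n P L}

theorem fpolyZero_cons {B : Matrix (Fin n) (Fin n) ℤ} {d : Fin n → ℕ}
    (hB : IsSkewSymmetrizable B) (hd : ∀ i, 0 < d i) (t : List (Fin n)) (k : Fin n) :
    FpolyZero B d (k :: t) = Function.update (FpolyZero B d t) k
      (exchange var (FpolyZero B d t) (cVec B d t) (exchangeMatrix B d t) (d k) k
        (1 + coeffMonomial var (FpolyZero B d t) (cVec B d t) (exchangeMatrix B d t) k ^ d k)) := by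
  have h := isFormalSeed_formalAt hB hd t
  have e := congrFun h.d_eq k
  have h' := (IsFormalSeed.eq (t := k :: t) (h.mutate k)).2.2
  rw [e] at h'
  exact h'

theorem gDegreeAt_cons {B : Matrix (Fin n) (Fin n) ℤ} {d : Fin n → ℕ}
    (hB : IsSkewSymmetrizable B) (hd : ∀ i, 0 < d i) (t : List (Fin n)) (k : Fin n) :
    gDegreeAt B d (k :: t) = Function.update (gDegreeAt B d t) k
      (exchange (fun i => Multiplicative.ofAdd (gDegree B d (Sum.inr (Sum.inl i))))
        (gDegreeAt B d t) (cVec B d t) (exchangeMatrix B d t) (d k) k 1) := by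
  have h := isFormalSeed_formalAt hB hd t
  have e := congrFun h.d_eq k
  have h' := (IsFormalSeed.eq (t := k :: t) (h.mutate k)).1
  rw [e] at h'
  exact h'

theorem cVec_cons {B : Matrix (Fin n) (Fin n) ℤ} {d : Fin n → ℕ}
    (hB : IsSkewSymmetrizable B) (hd : ∀ i, 0 < d i) (t : List (Fin n)) (k : Fin n) :
    cVec B d (k :: t) = mutateC (cVec B d t) (exchangeMatrix B d t) (d k) k := by
  have h := isFormalSeed_formalAt hB hd t
  have h' := h.coeff.cMatrix_mutate k
  rw [congrFun h.d_eq k] at h'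
  exact h'

theorem exchangeMatrix_cons {B : Matrix (Fin n) (Fin n) ℤ} {d : Fin n → ℕ}
    (hB : IsSkewSymmetrizable B) (hd : ∀ i, 0 < d i) (t : List (Fin n)) (k : Fin n) :
    exchangeMatrix B d (k :: t) = mutateB (exchangeMatrix B d t) (d k) k := by
  rw [← congrFun (isFormalSeed_formalAt hB hd t).d_eq k]
  rfl

theorem fpolyZero_nil {B : Matrix (Fin n) (Fin n) ℤ} {d : Fin n → ℕ}
    (hB : IsSkewSymmetrizable B) (hd : ∀ i, 0 < d i) : FpolyZero B d [] = 1 :=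
  (IsFormalSeed.eq (t := []) (isFormalSeed_formalSeed hB hd)).2.2

theorem gVec_nil {B : Matrix (Fin n) (Fin n) ℤ} {d : Fin n → ℕ}
    (hB : IsSkewSymmetrizable B) (hd : ∀ i, 0 < d i) (i j : Fin n) :
    gVec B d [] i j = (Pi.single j 1 : Fin n → ℤ) i :=
  congrFun (congrFun (IsFormalSeed.eq (t := []) (isFormalSeed_formalSeed hB hd)).1 j) i

theorem isMulRel_coeffHom : IsMulRel fun (p : P) (a : L) => a = coeffHom P L p where
  one := (map_one _).symm
  mul := by
    rintro p q _ _ rfl rfl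
    exact (map_mul _ _ _).symm
  inv := by
    rintro p _ rfl
    exact (eq_inv_of_mul_eq_one_left (by rw [← map_mul, inv_mul_cancel, map_one])).symm

theorem GenSeed.xAtZero_eq (S : GenSeed n P L) (t : List (Fin n)) : S.xAtZero t =
    (fun j => ∏ i, S.x i ^ gVec S.B S.d t i j) *
      ((fun j => ratEval S.hat (FpolyZero S.B S.d t j)) /
        fun j => coeffHom P L (specialize S.y (FpolyZero S.B S.d t j))) := rfl

theorem GenSeed.yAtZero_eq {P L : Type*} [CommGroup P] [AddCommSemigroup P]
    (S : GenSeed n P L) (t : List (Fin n)) : S.yAtZero t =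
    coeffMonomial S.y (fun j => specialize S.y (FpolyZero S.B S.d t j)) (cVec S.B S.d t)
      (exchangeMatrix S.B S.d t) := rfl

namespace GenSeed.IsGenSeed

variable (hS : S.IsGenSeed)

include hS

theorem x_ne_zero (i : Fin n) : S.x i ≠ 0 := hS.algebraicIndependent.ne_zero i

theorem fpolyZero_isSubtractionFree (t : List (Fin n)) (j : Fin n) :
    IsSubtractionFree (FpolyZero S.B S.d t j) :=
  (isFormalSeed_formalAt hS.skewSymmetrizable hS.d_pos t).subtractionFree j

theorem evalsToUnit_fpolyZero (t : List (Fin n)) (j : Fin n) :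
    EvalsToUnit S.hat (FpolyZero S.B S.d t j) (ratEval S.hat (FpolyZero S.B S.d t j)) := by
  obtain ⟨C, hC, hx⟩ := hS.exists_isPositiveCone
  exact hC.evalsToUnit hx (hS.fpolyZero_isSubtractionFree t j)

theorem hat_ne_zero (k : Fin n) : S.hat k ≠ 0 := by
  obtain ⟨C, hC, hx⟩ := hS.exists_isPositiveCone
  exact fun h => hC.zero_notMem (h ▸ hx k)

theorem specialize_cons (t : List (Fin n)) (k : Fin n) :
    (fun j => specialize S.y (FpolyZero S.B S.d (k :: t) j)) =
      Function.update (fun j => specialize S.y (FpolyZero S.B S.d t j)) k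
        (exchange S.y (fun j => specialize S.y (FpolyZero S.B S.d t j)) (cVec S.B S.d t)
          (exchangeMatrix S.B S.d t) (S.d k) k
          (1 + coeffMonomial S.y (fun j => specialize S.y (FpolyZero S.B S.d t j))
            (cVec S.B S.d t) (exchangeMatrix S.B S.d t) k ^ S.d k)) := by
  have hs := isMulRel_specializesTo S.y
  have hf := fun j => (hS.fpolyZero_isSubtractionFree t j).specializesTo S.y
  funext j
  apply SpecializesTo.specialize_eq
  rw [fpolyZero_cons hS.skewSymmetrizable hS.d_pos]
  exact forall_update hf (hs.exchange _ _ (specializesTo_var _) hf _ k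
    (hs.one.add (hs.pow (hs.coeffMonomial _ _ (specializesTo_var _) hf k) _))) j

theorem ratEval_cons (t : List (Fin n)) (k : Fin n) :
    (fun j => ratEval S.hat (FpolyZero S.B S.d (k :: t) j)) =
      Function.update (fun j => ratEval S.hat (FpolyZero S.B S.d t j)) k
        (exchange S.hat (fun j => ratEval S.hat (FpolyZero S.B S.d t j)) (cVec S.B S.d t)
          (exchangeMatrix S.B S.d t) (S.d k) k
          (1 + coeffMonomial S.hat (fun j => ratEval S.hat (FpolyZero S.B S.d t j))
            (cVec S.B S.d t) (exchangeMatrix S.B S.d t) k ^ S.d k)) := by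
  have hs := isMulRel_evalsToUnit S.hat
  have hf := hS.evalsToUnit_fpolyZero t
  have hv : ∀ i, EvalsToUnit S.hat (var i) (S.hat i) :=
    fun i => ⟨evalsTo_var _ i, hS.hat_ne_zero i⟩
  have hw := (evalsTo_one S.hat).add (hs.pow (hs.coeffMonomial (cVec S.B S.d t)
    (exchangeMatrix S.B S.d t) hv hf k) (S.d k)).1
  have hne : ∀ w : L, EvalsTo S.hat (1 + coeffMonomial var (FpolyZero S.B S.d t)
      (cVec S.B S.d t) (exchangeMatrix S.B S.d t) k ^ S.d k) w → w ≠ 0 := by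
    intro w hw
    obtain ⟨C, hC, hx⟩ := hS.exists_isPositiveCone
    have hsp := isMulRel_specializesTo S.y
    have h1 := hC.evalsToUnit hx (hsp.one.add (hsp.pow (hsp.coeffMonomial (cVec S.B S.d t)
      (exchangeMatrix S.B S.d t) (specializesTo_var _)
      (fun j => (hS.fpolyZero_isSubtractionFree t j).specializesTo S.y) k)
      (S.d k))).isSubtractionFree
    rw [hw.unique h1.1]
    exact h1.2
  funext j
  apply EvalsTo.ratEval_eq
  rw [fpolyZero_cons hS.skewSymmetrizable hS.d_pos]
  exact (forall_update hf (hs.exchange _ _ hv hf _ k ⟨hw, hne _ hw⟩) j).1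

/-- Monomials in the initial cluster are multiplicative in their exponent vector. -/
theorem isMulRel_monomial : IsMulRel fun (g : Multiplicative (Fin n → ℤ)) (a : L) =>
    a = ∏ i, S.x i ^ g.toAdd i where
  one := by simp
  mul := by
    rintro g g' _ _ rfl rfl
    rw [← Finset.prod_mul_distrib]
    exact Finset.prod_congr rfl fun i _ => (zpow_add₀ (hS.x_ne_zero i) _ _).symm
  inv := by
    rintro g _ rfl
    rw [← Finset.prod_inv_distrib]
    exact Finset.prod_congr rfl fun i _ => (zpow_neg _ _).symm

theorem prod_gVec_cons (t : List (Fin n)) (k : Fin n) :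
    (fun j => ∏ i, S.x i ^ gVec S.B S.d (k :: t) i j) =
      Function.update (fun j => ∏ i, S.x i ^ gVec S.B S.d t i j) k
        (exchange (fun j => ∏ i, S.x i ^ (-S.B i j)) (fun j => ∏ i, S.x i ^ gVec S.B S.d t i j)
          (cVec S.B S.d t) (exchangeMatrix S.B S.d t) (S.d k) k 1) := by
  have hs := hS.isMulRel_monomial
  funext j
  refine Eq.symm ?_
  change _ = ∏ i, S.x i ^ (gDegreeAt S.B S.d (k :: t) j).toAdd i
  rw [gDegreeAt_cons hS.skewSymmetrizable hS.d_pos]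
  exact forall_update (R := fun (a : L) (g : Multiplicative (Fin n → ℤ)) =>
      a = ∏ i, S.x i ^ g.toAdd i) (fun j => rfl)
    (hs.exchange _ _ (fun i => rfl) (fun i => rfl) _ k hs.one) j

theorem coeffMonomial_gVec (t : List (Fin n)) (j : Fin n) :
    coeffMonomial (fun j => ∏ i, S.x i ^ (-S.B i j)) (fun j => ∏ i, S.x i ^ gVec S.B S.d t i j)
      (cVec S.B S.d t) (exchangeMatrix S.B S.d t) j = 1 := by
  have hs := hS.isMulRel_monomial
  have h := hs.coeffMonomial (cVec S.B S.d t) (exchangeMatrix S.B S.d t)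
    (x := fun i => Multiplicative.ofAdd (gDegree S.B S.d (Sum.inr (Sum.inl i))))
    (y := gDegreeAt S.B S.d t) (fun i => rfl) (fun i => rfl) j
  have h1 : coeffMonomial
      (fun i => Multiplicative.ofAdd (gDegree S.B S.d (Sum.inr (Sum.inl i))))
      (gDegreeAt S.B S.d t) (cVec S.B S.d t) (exchangeMatrix S.B S.d t) j = 1 :=
    (isFormalSeed_formalAt hS.skewSymmetrizable hS.d_pos t).degree_hat j
  refine h.trans ?_
  rw [h1]
  simp

theorem mul_hat_div :
    (fun j => ∏ i, S.x i ^ (-S.B i j)) * (S.hat / fun j => coeffHom P L (S.y j)) = 1 := by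
  funext j
  have h1 : (∏ i, S.x i ^ (-S.B i j)) * ∏ i, S.x i ^ S.B i j = 1 := by
    rw [← Finset.prod_mul_distrib]
    refine Finset.prod_eq_one fun i _ => ?_
    rw [← zpow_add₀ (hS.x_ne_zero i), neg_add_cancel, zpow_zero]
  simp only [Pi.mul_apply, Pi.div_apply, Pi.one_apply, GenSeed.hat, hatY]
  rw [mul_div_cancel_left₀ _ (coeffHom_ne_zero _), h1]

/-- The `ŷ`-variables at `z = 0`. -/
theorem hatY_atZero (t : List (Fin n)) (j : Fin n) :
    coeffHom P L (S.yAtZero t j) * ∏ i, S.xAtZero t i ^ exchangeMatrix S.B S.d t i j =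
      coeffMonomial S.hat (fun j => ratEval S.hat (FpolyZero S.B S.d t j)) (cVec S.B S.d t)
        (exchangeMatrix S.B S.d t) j := by
  have h1 : ∏ i, S.xAtZero t i ^ exchangeMatrix S.B S.d t i j =
      coeffMonomial 1 (S.xAtZero t) (cVec S.B S.d t) (exchangeMatrix S.B S.d t) j := by
    simp [coeffMonomial]
  have h2 := coeffMonomial_one_eq (cVec S.B S.d t) (exchangeMatrix S.B S.d t)
    (f₀ := fun j => ∏ i, S.x i ^ gVec S.B S.d t i j)
    (f := fun j => ratEval S.hat (FpolyZero S.B S.d t j))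
    (p := fun j => coeffHom P L (specialize S.y (FpolyZero S.B S.d t j))) hS.mul_hat_div j
  rw [hS.coeffMonomial_gVec, one_mul] at h2
  rw [h1, S.xAtZero_eq, h2, S.yAtZero_eq,
    isMulRel_coeffHom.coeffMonomial (cVec S.B S.d t) (exchangeMatrix S.B S.d t) (x := S.y)
      (y := fun j => specialize S.y (FpolyZero S.B S.d t j)) (fun i => rfl) (fun i => rfl) j,
    mul_div_cancel₀ _ (coeffHom_ne_zero _)]

theorem xAtZero_cons (t : List (Fin n)) (k : Fin n) :
    S.xAtZero (k :: t) = Function.update (S.xAtZero t) k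
      ((S.xAtZero t k)⁻¹ *
        (∏ i, S.xAtZero t i ^ max (-exchangeMatrix S.B S.d t i k) 0) ^ S.d k *
        ((1 + (coeffHom P L (S.yAtZero t k) *
          ∏ i, S.xAtZero t i ^ exchangeMatrix S.B S.d t i k) ^ S.d k) /
          coeffHom P L (1 + S.yAtZero t k ^ S.d k))) := by
  have h1 : ∀ w : L, (S.xAtZero t k)⁻¹ *
      (∏ i, S.xAtZero t i ^ max (-exchangeMatrix S.B S.d t i k) 0) ^ S.d k * w =
      exchange 1 (S.xAtZero t) (cVec S.B S.d t) (exchangeMatrix S.B S.d t) (S.d k) k w := by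
    simp [exchange]
  funext j
  rw [h1, hS.hatY_atZero, S.xAtZero_eq (k :: t), hS.prod_gVec_cons,
    hS.ratEval_cons]
  have e : (fun j => coeffHom P L (specialize S.y (FpolyZero S.B S.d (k :: t) j))) =
      Function.update (fun j => coeffHom P L (specialize S.y (FpolyZero S.B S.d t j))) k
        (exchange (fun j => coeffHom P L (S.y j))
          (fun j => coeffHom P L (specialize S.y (FpolyZero S.B S.d t j))) (cVec S.B S.d t)
          (exchangeMatrix S.B S.d t) (S.d k) k (coeffHom P L (1 + S.yAtZero t k ^ S.d k))) := by
    have e1 := hS.specialize_cons t k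
    funext j
    rw [congrFun e1 j]
    refine Eq.symm (forall_update (R := fun (a : L) p => a = coeffHom P L p) (fun j => rfl) ?_ j)
    exact isMulRel_coeffHom.exchange _ _ (fun i => rfl) (fun i => rfl) _ k rfl
  rw [e]
  by_cases hj : j = k
  · subst hj
    simp only [Pi.mul_apply, Pi.div_apply, Function.update_self]
    exact (exchange_one_eq _ _ hS.mul_hat_div _ _ _ _).symm
  · simp only [Pi.mul_apply, Pi.div_apply, Function.update_of_ne hj]
    rfl

theorem yAtZero_cons (t : List (Fin n)) (k j : Fin n) :
    S.yAtZero (k :: t) j = if j = k then (S.yAtZero t k)⁻¹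
      else S.yAtZero t j * (S.yAtZero t k ^ S.d k) ^ max (exchangeMatrix S.B S.d t k j) 0 *
        (1 + S.yAtZero t k ^ S.d k) ^ (-exchangeMatrix S.B S.d t k j) := by
  have hk := (isFormalSeed_formalAt hS.skewSymmetrizable hS.d_pos t).skew.apply_self k
  rw [S.yAtZero_eq (k :: t), hS.specialize_cons, cVec_cons hS.skewSymmetrizable hS.d_pos,
    exchangeMatrix_cons hS.skewSymmetrizable hS.d_pos]
  exact coeffMonomial_exchange _ _ _ _ _ _ hk _ _

theorem rightCompanionAt_eq (t : List (Fin n)) :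
    (S.rightCompanionAt t).x = S.xAtZero t ∧
    (∀ j, (S.rightCompanionAt t).y j = S.yAtZero t j ^ S.d j) ∧
    (∀ i j, (S.rightCompanionAt t).B i j = exchangeMatrix S.B S.d t i j * S.d j) := by
  classical
  induction t with
  | nil =>
    have hf := fpolyZero_nil hS.skewSymmetrizable hS.d_pos
    have hs : ∀ j, specialize S.y (FpolyZero S.B S.d [] j) = 1 := fun j =>
      SpecializesTo.specialize_eq (by rw [hf]; exact (isMulRel_specializesTo S.y).one)
    have hr : ∀ j, ratEval S.hat (FpolyZero S.B S.d [] j) = 1 := fun j =>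
      EvalsTo.ratEval_eq (by rw [hf]; exact evalsTo_one _)
    refine ⟨?_, fun j => ?_, fun i j => ?_⟩
    · funext j
      rw [GenSeed.xAtZero, hs, hr, map_one, div_one, mul_one]
      simp only [gVec_nil hS.skewSymmetrizable hS.d_pos]
      rw [Finset.prod_eq_single j]
      · simp [GenSeed.rightCompanionAt, Seed.at, GenSeed.rightCompanion]
      · intro i _ hi
        simp [hi]
      · simp
    · simp only [GenSeed.yAtZero, hs, one_zpow, Finset.prod_const_one, mul_one]
      have hc : ∀ i, cVec S.B S.d [] i j = if j = i then 1 else 0 := fun i => by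
        simp [cVec, formalAt, GenSeed.at, formalSeed, Trop.exponent_gen, Finsupp.single_apply]
      simp only [hc]
      rw [Finset.prod_eq_single j]
      · simp [GenSeed.rightCompanionAt, Seed.at, GenSeed.rightCompanion]
      · intro i _ hi
        simp [Ne.symm hi]
      · simp
    · simp [GenSeed.rightCompanionAt, Seed.at, GenSeed.rightCompanion, exchangeMatrix, formalAt,
        GenSeed.at, formalSeed, Matrix.mul_diagonal]
  | cons k t ih =>
    obtain ⟨hx, hy, hB⟩ := ih
    have hcons : S.rightCompanionAt (k :: t) =
      (S.rightCompanionAt t).mutate (coeffHom P L) k := rfl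
    have hmax : ∀ (a : ℤ) (m : ℕ), max (a * m) 0 = max a 0 * m := fun a m => by
      rw [max_mul_of_nonneg _ _ (Int.natCast_nonneg m), zero_mul]
    refine ⟨?_, fun j => ?_, fun i j => ?_⟩
    · rw [hcons, hS.xAtZero_cons]
      funext j
      by_cases hj : j = k
      · subst hj
        simp only [Seed.mutate, if_true, Function.update_self, hatY, hx, hy, hB, ← neg_mul, hmax,
          zpow_mul, zpow_natCast, Finset.prod_pow, map_pow, mul_pow]
      · simp [Seed.mutate, hj, hx]
    · rw [hcons, hS.yAtZero_cons]
      by_cases hj : j = k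
      · subst hj
        simp [Seed.mutate, hy]
      · simp only [Seed.mutate, hj, if_false, hy, hB, ← neg_mul, hmax, zpow_mul, zpow_natCast,
          mul_pow]
    · rw [hcons, exchangeMatrix_cons hS.skewSymmetrizable hS.d_pos]
      by_cases h : i = k ∨ j = k
      · simp [Seed.mutate, mutateB, h, hB]
      · simp only [Seed.mutate, mutateB, h, hB, if_false, Matrix.of_apply, ← neg_mul, hmax]
        ring

end GenSeed.IsGenSeed

end AtZero

end ClusterAlg

end

theorem mainTheorem2 {n : ℕ} {P : Type*} [CommGroup P] [AddCommSemigroup P] [LeftDistribClass P]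
    {L : Type*} [Field L] [Algebra (ClusterAlg.QP P) L]
    (S : ClusterAlg.GenSeed n P L) (hS : S.IsGenSeed) (t : ClusterAlg.TreeVertex n) :
    -- the quantities in the formulas are well defined
    (∀ j, (∃ g, ClusterAlg.IsHomogeneousOfDegree (ClusterAlg.gDegree S.B S.d)
        (ClusterAlg.Xfun S.B S.d t.1 j) g) ∧
      ClusterAlg.IsDefinedAt (ClusterAlg.Xfun S.B S.d t.1 j) (ClusterAlg.xOne S.d) ∧
      ClusterAlg.IsDefinedAt (ClusterAlg.Fpoly S.B S.d t.1 j) (ClusterAlg.zZero S.d) ∧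
      ClusterAlg.IsSubtractionFree (ClusterAlg.FpolyZero S.B S.d t.1 j) ∧
      ClusterAlg.IsDefinedAt (ClusterAlg.FpolyZero S.B S.d t.1 j) S.hat) ∧
    -- cluster variables
    (∀ i, S.xAtZero t.1 i = (S.rightCompanionAt t.1).x i) ∧
    -- coefficients
    (∀ j, S.yAtZero t.1 j ^ S.d j = (S.rightCompanionAt t.1).y j) := by
  refine ⟨fun j => ?_, fun i => ?_, fun j => ?_⟩
  · have h := ClusterAlg.isFormalSeed_formalAt hS.skewSymmetrizable hS.d_pos t.1
    exact ⟨⟨_, h.hom j⟩, (h.evals_x j).1.isDefinedAt, (h.evals_F j).1.isDefinedAt,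
      h.subtractionFree j, (hS.evalsToUnit_fpolyZero t.1 j).1.isDefinedAt⟩
  · rw [(hS.rightCompanionAt_eq t.1).1]
  · rw [(hS.rightCompanionAt_eq t.1).2.1]
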